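/- All graphs are finite and simple. For a set $F$ of edges of a graph let $V(F)$ denote the set of vertices incident with $F$. The simple $(2,2)$-sparse matroid $\mathcal{M}^*_{2,2}(G)$ is the matroid on $E(G)$ in which $F\subseteq E(G)$ is independent if and only if $|F'|\le 2|V(F')|-2$ for all $\emptyset\ne F'\subseteq F$, with strict inequality when $|F'|=2$. An $\mathcal{M}^*_{2,2}$-circuit is a graph $G$ without isolated vertices such that $E(G)$ is a circuit (a minimal dependent set) of $\mathcal{M}^*_{2,2}(G)$. Let $K_5-e$ be the complete graph on five vertices with one edge removed, and let $H_1$ be the graph on six vertices formed by two copies of $K_4$ which have exactly one edge (and its two end-vertices) in common. A $K_4^-$-extension of $G$ deletes an edge $v_1v_2$ of $G$, and adds two new vertices $u_1,u_2$ and the five edges $u_1u_2,u_1v_1,u_1v_2,u_2v_1,u_2v_2$. A generalised vertex split of $G=(V,E)$ chooses a vertex $v\in V$, a partition $N_1,N_2$ of the set of neighbours of $v$ into two non-empty sets, and a vertex $x\in V\setminus(N_1\cup\{v\})$; it deletes $v$, adds two new vertices $v_1,v_2$ joined to the vertices in $N_1$ and in $N_2$, respectively, and adds the two edges $v_1v_2$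 and $v_1x$. Theorem. Let $G$ be an $\mathcal{M}^*_{2,2}$-circuit. Then there is a finite sequence of graphs $G_0,G_1,\dots,G_k$ with $k\ge 0$ such that $G_0$ is isomorphic to $K_5-e$ or to $H_1$, $G_k=G$, each $G_{i+1}$ is isomorphic to a graph obtained from $G_i$ by a $K_4^-$-extension or by a generalised vertex split, and every $G_i$ is an $\mathcal{M}^*_{2,2}$-circuit. -/

import Mathlib

namespace CylinderRigidity

universe u v

/-- The set `V(F)` of vertices incident to the edges of `F`. -/
def edgeVerts {V : Type u} (F : Set (Sym2 V)) : Set V :=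
  {a | ∃ e ∈ F, a ∈ e}

/-- Independence in the simple `(2,2)`-sparse matroid (for edge sets of finite graphs):
`|F'| ≤ 2|V(F')| - 2` for all `∅ ≠ F' ⊆ F`, with strict inequality when `|F'| = 2`. -/
def Indep {V : Type u} (F : Set (Sym2 V)) : Prop :=
  ∀ F' ⊆ F, F'.Nonempty →
    F'.ncard + 2 ≤ 2 * (edgeVerts F').ncard ∧
    (F'.ncard = 2 → F'.ncard + 2 < 2 * (edgeVerts F').ncard)

/-- `G` is an `M*_{2,2}`-circuit: a finite simple graph without isolated vertices whose edge set
is a circuit, i.e. a minimal dependent set, of the simple `(2,2)`-sparse matroid. -/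
structure IsCircuit {V : Type u} (G : SimpleGraph V) : Prop where
  finite : Finite V
  minimal_dep : Minimal (fun F : Set (Sym2 V) => ¬ Indep F) G.edgeSet
  no_isolated : ∀ a, ∃ b, G.Adj a b

/-- `K₅` minus one edge. -/
def K5e : SimpleGraph (Fin 5) :=
  (⊤ : SimpleGraph (Fin 5)).deleteEdges {s(2, 4)}

/-- Two copies of `K₄`, on `{0, 1, 2, 3}` and on `{0, 3, 4, 5}`, sharing the edge `{0, 3}`. -/
def H1 : SimpleGraph (Fin 6) :=
  SimpleGraph.fromEdgeSet
    {s(0, 1), s(0, 2), s(0, 3), s(1, 2), s(1, 3), s(2, 3),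
      s(0, 4), s(0, 5), s(3, 4), s(3, 5), s(4, 5)}

/-- Delete the edge `ab` from `G`, add two new vertices `Sum.inr 0`, `Sum.inr 1`, join each of them
to `a` and to `b`, and join them to each other. (`SimpleGraph.fromRel` symmetrises the relation and
drops the loops.) -/
def k4MinusExtend {V : Type u} (G : SimpleGraph V) (a b : V) : SimpleGraph (V ⊕ Fin 2) :=
  SimpleGraph.fromRel fun p q =>
    match p, q with
    | Sum.inl c, Sum.inl d => G.Adj c d ∧ s(c, d) ≠ s(a, b)
    | Sum.inr _, Sum.inl c => c = a ∨ c = b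
    | Sum.inr _, Sum.inr _ => True
    | Sum.inl _, Sum.inr _ => False

/-- Delete the vertex `v` from `G`, add two new vertices `v₁ = Sum.inr 0` and `v₂ = Sum.inr 1`
joined to `N₁` and `N₂` respectively, and add the edges `v₁v₂` and `v₁x`. -/
def vertexSplit {V : Type u} (G : SimpleGraph V) (v : V) (N₁ N₂ : Set V) (x : V) :
    SimpleGraph ({c : V // c ≠ v} ⊕ Fin 2) :=
  SimpleGraph.fromRel fun p q =>
    match p, q with
    | Sum.inl c, Sum.inl d => G.Adj c.1 d.1
    | Sum.inr i, Sum.inl c => (i = 0 ∧ (c.1 ∈ N₁ ∨ c.1 = x)) ∨ (i = 1 ∧ c.1 ∈ N₂)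
    | Sum.inr _, Sum.inr _ => True
    | Sum.inl _, Sum.inr _ => False

/-- `G'` is, up to isomorphism, obtained from `G` by a `K₄⁻`-extension along an edge. -/
def IsK4MinusExtension {V : Type u} {W : Type v} (G : SimpleGraph V) (G' : SimpleGraph W) : Prop :=
  ∃ a b, G.Adj a b ∧ Nonempty (G' ≃g k4MinusExtend G a b)

/-- `G'` is, up to isomorphism, obtained from `G` by a generalised vertex split: `N₁, N₂` is a
partition of the neighbours of `v`, and `x` is a vertex of `G - v` outside `N₁`. -/
def IsGeneralisedVertexSplit {V : Type u} {W : Type v}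
    (G : SimpleGraph V) (G' : SimpleGraph W) : Prop :=
  ∃ (v : V) (N₁ N₂ : Set V) (x : V),
    N₁.Nonempty ∧ N₂.Nonempty ∧ Disjoint N₁ N₂ ∧ N₁ ∪ N₂ = G.neighborSet v ∧
    x ≠ v ∧ x ∉ N₁ ∧ Nonempty (G' ≃g vertexSplit G v N₁ N₂ x)

/-- `G` can be obtained from (a copy of) `B` by recursively applying `K₄⁻`-extensions and
generalised vertex splits, in such a way that all the graphs in the sequence, the first and the last
one included, are `M*_{2,2}`-circuits. -/
inductive ObtainableFrom {U : Type v} (B : SimpleGraph U) :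
    ∀ {W : Type u}, SimpleGraph W → Prop
  | base {W : Type u} (G : SimpleGraph W) :
      Nonempty (G ≃g B) → IsCircuit G → ObtainableFrom B G
  | k4MinusExtension {V W : Type u} (G : SimpleGraph V) (G' : SimpleGraph W) :
      ObtainableFrom B G → IsK4MinusExtension G G' → IsCircuit G' → ObtainableFrom B G'
  | generalisedVertexSplit {V W : Type u} (G : SimpleGraph V) (G' : SimpleGraph W) :
      ObtainableFrom B G → IsGeneralisedVertexSplit G G' → IsCircuit G' → ObtainableFrom B G'

end CylinderRigidity

/-! Put `slack X = 4|X| - 2e(X)`. A finite graph is a circuit iff its whole vertex set has slack 2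
and every other nonempty set has slack at least 4; proper sets of slack 4 are tight. Slack is
submodular, with an error term counting edges between the differences. By induction on `|V|`, it
suffices to undo a move on any circuit other than `K5e` and `H1` so that a circuit remains. If this
is impossible, then whenever contracting `uv` and dropping `ux` would undo a vertex split, a tight
set contains `u`, `v` but not `x`.

Call vertices of degree 3 nodes. The neighbours of a node form a clique or an independent set
(`cliqueNode_or_indepNode`). A non-node adjacent to a clique node has degree at least 5
(`five_le_degree`), and distinct `K₄`s around clique nodes share at most one vertex
(`nbhd_eq_of_two_common`). Discharging gives average degree at least 4 on every set whose nodes are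
clique nodes with all neighbours in the set (`four_mul_card_le`). A circuit has average degree below
4, so independent nodes exist, and one of them, `v`, has a non-node neighbour `z`.

Then some tight `X` avoids `v` and `z` but contains the other neighbours of `v`. Choose such `v`,
`z`, `X` with `|X|` maximum; `P = X + v` is tight. Maximality makes every node outside `P` a clique
node without neighbours in `P`, so discharging applies to the complement of `P` and contradicts its
sparsity. -/

namespace CylinderRigidity

universe u

set_option linter.unusedSectionVars false

/-! ### Edge counts and the slack of a vertex set -/

section Counting

variable {V : Type u} [DecidableEq V] (G : SimpleGraph V) [DecidableRel G.Adj]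

/-- The number of pairs `(a, b)` with `a ∈ X`, `b ∈ Y` and `a`, `b` adjacent. -/
def cnt (X Y : Finset V) : ℤ := ∑ a ∈ X, ∑ b ∈ Y, if G.Adj a b then 1 else 0

/-- Twice the amount by which `X` misses spanning `2|X|` edges. -/
def slack (X : Finset V) : ℤ := 4 * X.card - cnt G X X

lemma cnt_nonneg (X Y : Finset V) : 0 ≤ cnt G X Y :=
  Finset.sum_nonneg fun a _ => Finset.sum_nonneg fun b _ => by split_ifs <;> simp

lemma cnt_comm (X Y : Finset V) : cnt G X Y = cnt G Y X := by
  unfold cnt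
  rw [Finset.sum_comm]
  simp [G.adj_comm]

lemma cnt_union_left {X Y : Finset V} (h : Disjoint X Y) (Z : Finset V) :
    cnt G (X ∪ Y) Z = cnt G X Z + cnt G Y Z := by
  unfold cnt
  rw [Finset.sum_union h]

lemma cnt_union_right {X Y : Finset V} (h : Disjoint X Y) (Z : Finset V) :
    cnt G Z (X ∪ Y) = cnt G Z X + cnt G Z Y := by
  rw [cnt_comm, cnt_union_left G h, cnt_comm G X, cnt_comm G Y]

lemma cnt_mono {X X' Y Y' : Finset V} (hX : X ⊆ X') (hY : Y ⊆ Y') :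
    cnt G X Y ≤ cnt G X' Y' := by
  unfold cnt
  refine (Finset.sum_le_sum fun a _ => ?_).trans
    (Finset.sum_le_sum_of_subset_of_nonneg hX fun a _ _ => ?_)
  · exact Finset.sum_le_sum_of_subset_of_nonneg hY fun b _ _ => by split_ifs <;> simp
  · exact Finset.sum_nonneg fun b _ => by split_ifs <;> simp

lemma cnt_singleton (a : V) (X : Finset V) : cnt G {a} X = (X.filter (G.Adj a)).card := by
  simp [cnt]

lemma cnt_eq_sum (X Y : Finset V) : cnt G X Y = ∑ a ∈ X, cnt G {a} Y := by
  simp [cnt]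

lemma cnt_pos {X Y : Finset V} {a b : V} (ha : a ∈ X) (hb : b ∈ Y) (h : G.Adj a b) :
    1 ≤ cnt G X Y := by
  have h1 : cnt G {a} {b} = 1 := by
    simp only [cnt, Finset.sum_singleton, h, if_true]
  rw [← h1]
  exact cnt_mono G (by simpa using ha) (by simpa using hb)

lemma cnt_singleton_self (a : V) : cnt G {a} {a} = 0 := by simp [cnt]

/-- The submodularity identity. -/
lemma slack_union_add_inter (X Y : Finset V) :
    slack G (X ∪ Y) + slack G (X ∩ Y) = slack G X + slack G Y - 2 * cnt G (X \ Y) (Y \ X) := by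
  have hc : ((X ∪ Y).card : ℤ) + (X ∩ Y).card = X.card + Y.card := by
    exact_mod_cast Finset.card_union_add_card_inter X Y
  have hX : X = (X \ Y) ∪ (X ∩ Y) := (Finset.sdiff_union_inter X Y).symm
  have hY : Y = (Y \ X) ∪ (X ∩ Y) := by
    rw [Finset.inter_comm]; exact (Finset.sdiff_union_inter Y X).symm
  have hU : X ∪ Y = ((X \ Y) ∪ (X ∩ Y)) ∪ (Y \ X) := by
    ext a; simp only [Finset.mem_union, Finset.mem_sdiff, Finset.mem_inter]; tauto
  have d1 : Disjoint (X \ Y) (X ∩ Y) := by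
    rw [Finset.disjoint_left]; intro a; simp only [Finset.mem_sdiff, Finset.mem_inter]; tauto
  have d2 : Disjoint (Y \ X) (X ∩ Y) := by
    rw [Finset.disjoint_left]; intro a; simp only [Finset.mem_sdiff, Finset.mem_inter]; tauto
  have d3 : Disjoint ((X \ Y) ∪ (X ∩ Y)) (Y \ X) := by
    rw [Finset.disjoint_left]; intro a
    simp only [Finset.mem_sdiff, Finset.mem_inter, Finset.mem_union]; tauto
  have eX : cnt G X X = cnt G ((X \ Y) ∪ (X ∩ Y)) ((X \ Y) ∪ (X ∩ Y)) := by rw [← hX]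
  have eY : cnt G Y Y = cnt G ((Y \ X) ∪ (X ∩ Y)) ((Y \ X) ∪ (X ∩ Y)) := by rw [← hY]
  have eU : cnt G (X ∪ Y) (X ∪ Y) = cnt G (((X \ Y) ∪ (X ∩ Y)) ∪ (Y \ X))
      (((X \ Y) ∪ (X ∩ Y)) ∪ (Y \ X)) := by rw [← hU]
  simp only [cnt_union_left G d1, cnt_union_right G d1] at eX
  simp only [cnt_union_left G d2, cnt_union_right G d2] at eY
  simp only [cnt_union_left G d3, cnt_union_right G d3, cnt_union_left G d1,
    cnt_union_right G d1] at eU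
  have c1 := cnt_comm G (X \ Y) (X ∩ Y)
  have c2 := cnt_comm G (Y \ X) (X ∩ Y)
  have c3 := cnt_comm G (Y \ X) (X \ Y)
  unfold slack
  rw [eX, eY, eU]
  linarith

lemma slack_insert {w : V} {X : Finset V} (h : w ∉ X) :
    slack G (insert w X) = slack G X + 4 - 2 * cnt G {w} X := by
  have hd : Disjoint {w} X := by simpa using h
  unfold slack
  rw [Finset.card_insert_of_notMem h, Finset.insert_eq, cnt_union_left G hd,
    cnt_union_right G hd, cnt_union_right G hd, cnt_comm G X, cnt_singleton_self]
  push_cast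
  ring

lemma cnt_insert_self (w : V) (X : Finset V) : cnt G {w} (insert w X) = cnt G {w} X := by
  rw [cnt_singleton, cnt_singleton, Finset.filter_insert]
  simp

lemma slack_erase {w : V} {X : Finset V} (h : w ∈ X) :
    slack G (X.erase w) = slack G X - 4 + 2 * cnt G {w} X := by
  have h1 := slack_insert G (Finset.notMem_erase w X)
  have h2 := cnt_insert_self G w (X.erase w)
  rw [Finset.insert_erase h] at h1 h2
  rw [h1, h2]
  ring

lemma slack_singleton (a : V) : slack G {a} = 4 := by simp [slack, cnt]

lemma cnt_clique {X : Finset V} (h : ∀ a ∈ X, ∀ b ∈ X, a ≠ b → G.Adj a b) :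
    cnt G X X = X.card * (X.card - 1) := by
  have : ∀ a ∈ X, cnt G {a} X = X.card - 1 := by
    intro a ha
    have : X.filter (G.Adj a) = X.erase a := by
      ext b
      simp only [Finset.mem_filter, Finset.mem_erase]
      exact ⟨fun hb => ⟨hb.2.ne', hb.1⟩, fun hb => ⟨hb.2, h a ha b hb.2 hb.1.symm⟩⟩
    rw [cnt_singleton, this, Finset.card_erase_of_mem ha,
      Nat.cast_sub (Finset.card_pos.2 ⟨a, ha⟩)]
    simp
  rw [cnt_eq_sum, Finset.sum_congr rfl this, Finset.sum_const, nsmul_eq_mul]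

lemma cnt_neighbors {w : V} {N : Finset V} (h : ∀ c, G.Adj w c ↔ c ∈ N) (X : Finset V) :
    cnt G {w} X = (N ∩ X).card := by
  rw [cnt_singleton]
  congr 2
  ext c
  simp [h, and_comm]

lemma cnt_le_of_self (X : Finset V) : cnt G X X ≤ X.card * (X.card - 1) := by
  rw [← cnt_clique (⊤ : SimpleGraph V) (X := X) (by intros; simpa)]
  unfold cnt
  refine Finset.sum_le_sum fun a _ => Finset.sum_le_sum fun b _ => ?_
  by_cases h : G.Adj a b
  · simp [h, h.ne]
  · simp only [h, if_false]; split_ifs <;> simp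

end Counting

/-! ### Circuits in terms of vertex sets -/

section Circuits

variable {V : Type u} [Fintype V] [DecidableEq V] (G : SimpleGraph V) [DecidableRel G.Adj]

/-- Circuits of the simple `(2,2)`-sparse matroid in terms of vertex sets. -/
structure Circ : Prop where
  total : slack G Finset.univ = 2
  sparse : ∀ X : Finset V, X.Nonempty → X ≠ Finset.univ → 4 ≤ slack G X

lemma cnt_univ_eq_edges : cnt G Finset.univ Finset.univ = 2 * (G.edgeSet.ncard : ℤ) := by
  have h := G.sum_degrees_eq_twice_card_edges
  rw [Set.ncard_eq_toFinset_card', ← SimpleGraph.edgeFinset, cnt_eq_sum]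
  have : ∀ a ∈ (Finset.univ : Finset V), cnt G {a} Finset.univ = G.degree a := by
    intro a _
    rw [cnt_singleton, ← G.card_neighborFinset_eq_degree, G.neighborFinset_eq_filter]
  rw [Finset.sum_congr rfl this]
  exact_mod_cast h

lemma two_mul_ncard_le {F : Set (Sym2 V)} (hF : F ⊆ G.edgeSet) {X : Finset V}
    (hX : edgeVerts F ⊆ X) : 2 * (F.ncard : ℤ) ≤ cnt G X X := by
  classical
  have hE : (SimpleGraph.fromEdgeSet F).edgeSet = F := by
    rw [SimpleGraph.edgeSet_fromEdgeSet, sdiff_eq_left, Set.disjoint_left]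
    intro e he hd
    exact G.not_isDiag_of_mem_edgeSet (hF he) hd
  rw [← hE, ← cnt_univ_eq_edges]
  have key : cnt (SimpleGraph.fromEdgeSet F) Finset.univ Finset.univ =
      cnt (SimpleGraph.fromEdgeSet F) X X := by
    have hz : ∀ a b, a ∉ X → ¬ (SimpleGraph.fromEdgeSet F).Adj a b := by
      intro a b ha hab
      rw [SimpleGraph.fromEdgeSet_adj] at hab
      exact ha (hX ⟨_, hab.1, Sym2.mem_mk_left a b⟩)
    unfold cnt
    symm
    refine (Finset.sum_subset (Finset.subset_univ X) fun a _ ha => ?_).trans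
      (Finset.sum_congr rfl fun a _ => Finset.sum_subset (Finset.subset_univ X) fun b _ hb => ?_)
    · exact Finset.sum_eq_zero fun b _ => if_neg (hz a b ha)
    · exact if_neg fun h => hz b a hb h.symm
  rw [key]
  unfold cnt
  refine Finset.sum_le_sum fun a _ => Finset.sum_le_sum fun b _ => ?_
  by_cases h : G.Adj a b
  · simp only [h, if_true]; split_ifs <;> simp
  · have : ¬ (SimpleGraph.fromEdgeSet F).Adj a b := by
      rw [SimpleGraph.fromEdgeSet_adj]
      exact fun hab => h (hF hab.1)
    rw [if_neg this, if_neg h]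

lemma two_mul_ncard_inside (X : Finset V) :
    2 * ({e ∈ G.edgeSet | ∀ a ∈ e, a ∈ X}.ncard : ℤ) = cnt G X X := by
  classical
  set F : Set (Sym2 V) := {e ∈ G.edgeSet | ∀ a ∈ e, a ∈ X} with hFdef
  have hE : (SimpleGraph.fromEdgeSet F).edgeSet = F := by
    rw [SimpleGraph.edgeSet_fromEdgeSet, sdiff_eq_left, Set.disjoint_left]
    intro e he hd
    exact G.not_isDiag_of_mem_edgeSet he.1 hd
  have hadj : ∀ a b, (SimpleGraph.fromEdgeSet F).Adj a b ↔ G.Adj a b ∧ a ∈ X ∧ b ∈ X := by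
    intro a b
    rw [SimpleGraph.fromEdgeSet_adj]
    simp only [hFdef, Set.mem_ofPred_eq, SimpleGraph.mem_edgeSet, Sym2.mem_iff, forall_eq_or_imp,
      forall_eq]
    exact ⟨fun h => h.1, fun h => ⟨h, h.1.ne⟩⟩
  rw [← hE, ← cnt_univ_eq_edges]
  unfold cnt
  simp only [hadj]
  symm
  refine (Finset.sum_congr rfl fun a ha => ?_).trans
    (Finset.sum_subset (Finset.subset_univ X) fun a _ ha => ?_)
  · refine (Finset.sum_congr rfl fun b hb => ?_).trans
      (Finset.sum_subset (Finset.subset_univ X) fun b _ hb => ?_)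
    · simp [ha, hb]
    · simp [hb]
  · simp [ha]

/-- Two vertices of a simple graph carry at most one edge. Hence the strict inequality for `|F'| =
2` is automatic here, and only the count `2|V(F')| - 2` matters. -/
lemma three_le_ncard_edgeVerts {F : Set (Sym2 V)} (hF : F ⊆ G.edgeSet) (h : F.ncard = 2) :
    3 ≤ (edgeVerts F).ncard := by
  classical
  have h1 := two_mul_ncard_le G hF (X := (edgeVerts F).toFinset) (by simp)
  have h2 := cnt_le_of_self G (edgeVerts F).toFinset
  rw [← Set.ncard_eq_toFinset_card'] at h2
  rw [h] at h1
  by_contra! hlt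
  interval_cases (edgeVerts F).ncard <;> norm_num at h2 <;> norm_num at h1 <;> linarith

/-- By minimality a violating subset is all of `E`, so `|E| ≥ 2|V| - 1`; deleting one edge leaves an
independent set, so equality holds. As no vertex is isolated, the edges inside a proper vertex set
form a proper, hence independent, subset of `E`. -/
lemma circ_of_isCircuit (h : IsCircuit G) : Circ G := by
  classical
  obtain ⟨-, ⟨hdep, hmin⟩, hiso⟩ := h
  have huniv : edgeVerts G.edgeSet = Set.univ := by
    ext a
    obtain ⟨b, hb⟩ := hiso a
    simp only [Set.mem_univ, iff_true]
    exact ⟨s(a, b), hb, Sym2.mem_mk_left a b⟩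
  have hproper : ∀ F : Set (Sym2 V), F ⊆ G.edgeSet → F ≠ G.edgeSet → Indep F := by
    intro F hF hne
    by_contra hc
    exact hne (hF.antisymm (hmin hc hF))
  have hE : 2 * Fintype.card V < G.edgeSet.ncard + 2 ∧ G.edgeSet.Nonempty := by
    have hdep' := hdep
    unfold Indep at hdep'
    push Not at hdep'
    obtain ⟨F, hF, hFne, hF2⟩ := hdep'
    have hbad : (edgeVerts F).ncard * 2 < F.ncard + 2 := by
      by_contra! hle
      obtain ⟨h2, h3⟩ := hF2 (by omega)
      have := three_le_ncard_edgeVerts G hF h2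
      omega
    have hFE : F = G.edgeSet := by
      by_contra hne
      have := (hproper F hF hne F subset_rfl hFne).1
      omega
    subst hFE
    rw [huniv, Set.ncard_univ, Nat.card_eq_fintype_card] at hbad
    exact ⟨by omega, hFne⟩
  obtain ⟨hcard, e, he⟩ := hE
  have hV : 2 ≤ Fintype.card V := by
    induction e with
    | h a b => exact Fintype.one_lt_card_iff.2 ⟨a, b, (G.mem_edgeSet.1 he).ne⟩
  have hdel : (G.edgeSet \ {e}).ncard + 1 = G.edgeSet.ncard :=
    Set.ncard_sdiff_singleton_add_one he
  have hind := (hproper (G.edgeSet \ {e}) Set.sdiff_subset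
    (fun h => by rw [← h] at he; exact he.2 rfl) _ subset_rfl
    (by rw [← Set.ncard_pos]; omega)).1
  have hle : (edgeVerts (G.edgeSet \ {e})).ncard ≤ Fintype.card V := by
    rw [← Nat.card_eq_fintype_card, ← Set.ncard_univ]
    exact Set.ncard_le_ncard (Set.subset_univ _)
  refine ⟨?_, fun X hX hXu => ?_⟩
  · unfold slack
    rw [cnt_univ_eq_edges, Finset.card_univ]
    omega
  · have hin := two_mul_ncard_inside G X
    set F : Set (Sym2 V) := {e ∈ G.edgeSet | ∀ a ∈ e, a ∈ X} with hFdef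
    unfold slack
    rw [← hin]
    have hXc : 1 ≤ X.card := Finset.card_pos.2 hX
    by_cases hF : F.Nonempty
    · have hne : F ≠ G.edgeSet := by
        intro hFE
        obtain ⟨a, ha⟩ : ∃ a, a ∉ X := by
          by_contra! hall
          exact hXu (Finset.eq_univ_iff_forall.2 hall)
        obtain ⟨b, hb⟩ := hiso a
        have : s(a, b) ∈ F := by rw [hFE]; exact hb
        exact ha (this.2 a (Sym2.mem_mk_left a b))
      have h1 := (hproper F (fun e he => he.1) hne F subset_rfl hF).1
      have h2 : (edgeVerts F).ncard ≤ X.card := by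
        rw [← Set.ncard_coe_finset X]
        refine Set.ncard_le_ncard ?_
        rintro a ⟨e, he, hae⟩
        exact he.2 a hae
      omega
    · rw [Set.not_nonempty_iff_eq_empty.1 hF, Set.ncard_empty]
      omega

lemma Circ.three_le_cnt {G : SimpleGraph V} [DecidableRel G.Adj] (h : Circ G) (a : V) :
    3 ≤ cnt G {a} (Finset.univ : Finset V) := by
  have h1 := slack_erase G (Finset.mem_univ a)
  have h2 : ((Finset.univ : Finset V).erase a).Nonempty := by
    by_contra hne
    have h3 : (Finset.univ : Finset V) = {a} := by
      rw [Finset.not_nonempty_iff_eq_empty, Finset.erase_eq_empty_iff] at hne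
      rcases hne with hne | hne
      · exact absurd (Finset.mem_univ a) (by rw [hne]; simp)
      · exact hne
    have h4 := h.total
    rw [h3, slack_singleton] at h4
    omega
  have h3 := h.sparse _ h2 (fun he => by simpa using congrArg (a ∈ ·) he)
  have := h.total
  omega

/-- For minimality: a violating `F'` has `V(F')` of slack below 4, so `V(F') = V` and `F'` has at
least `2|V| - 1 = |E|` edges. -/
lemma Circ.isCircuit {G : SimpleGraph V} [DecidableRel G.Adj] (h : Circ G) : IsCircuit G := by
  classical
  have hiso : ∀ a, ∃ b, G.Adj a b := by
    intro a
    by_contra! hno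
    have := h.three_le_cnt a
    rw [cnt_singleton, Finset.filter_false_of_mem (fun b _ => hno b)] at this
    simp at this
  have huniv : edgeVerts G.edgeSet = Set.univ := by
    ext a
    obtain ⟨b, hb⟩ := hiso a
    simp only [Set.mem_univ, iff_true]
    exact ⟨s(a, b), hb, Sym2.mem_mk_left a b⟩
  have htot := h.total
  unfold slack at htot
  rw [cnt_univ_eq_edges, Finset.card_univ] at htot
  refine ⟨inferInstance, ⟨fun hind => ?_, fun F hF hFE => ?_⟩, hiso⟩
  · have := (hind G.edgeSet subset_rfl (by rw [← Set.ncard_pos]; omega)).1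
    rw [huniv, Set.ncard_univ, Nat.card_eq_fintype_card] at this
    omega
  · unfold Indep at hF
    push Not at hF
    obtain ⟨F', hF', hne, hbad⟩ := hF
    have hF'E := hF'.trans hFE
    have hbad' : (edgeVerts F').ncard * 2 < F'.ncard + 2 := by
      by_contra! hle
      obtain ⟨h2, h3⟩ := hbad (by omega)
      have := three_le_ncard_edgeVerts G hF'E h2
      omega
    have h1 := two_mul_ncard_le G hF'E (X := (edgeVerts F').toFinset) (by simp)
    have hc : (edgeVerts F').toFinset.card = (edgeVerts F').ncard :=
      (Set.ncard_eq_toFinset_card' _).symm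
    have hn : (edgeVerts F').toFinset.Nonempty := by
      obtain ⟨e, he⟩ := hne
      induction e with
      | h a b => exact ⟨a, by simpa using ⟨s(a, b), he, Sym2.mem_mk_left a b⟩⟩
    by_cases hu : (edgeVerts F').toFinset = Finset.univ
    · rw [hu, Finset.card_univ] at hc
      have : F' = G.edgeSet := Set.eq_of_subset_of_ncard_le hF'E (by omega)
      rw [← this]
      exact hF'
    · have h2 := h.sparse _ hn hu
      unfold slack at h2
      omega

end Circuits

/-! ### Tight sets and the neighbourhoods of nodes -/

section Tight

variable {V : Type u} [Fintype V] [DecidableEq V] {G : SimpleGraph V} [DecidableRel G.Adj]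

/-- A proper vertex set `Z` spanning exactly `2|Z| - 2` edges. -/
def Tight (G : SimpleGraph V) [DecidableRel G.Adj] (Z : Finset V) : Prop :=
  Z ≠ Finset.univ ∧ slack G Z = 4

lemma ne_univ_of_notMem {Z : Finset V} {a : V} (h : a ∉ Z) : Z ≠ Finset.univ := by
  rintro rfl
  exact h (Finset.mem_univ a)

lemma cnt_univ (G : SimpleGraph V) [DecidableRel G.Adj] (a : V) :
    cnt G {a} Finset.univ = G.degree a := by
  rw [cnt_singleton, ← G.card_neighborFinset_eq_degree, G.neighborFinset_eq_filter]

lemma cnt_neighborFinset (G : SimpleGraph V) [DecidableRel G.Adj] (a : V) (X : Finset V) :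
    cnt G {a} X = (G.neighborFinset a ∩ X).card :=
  cnt_neighbors G (fun c => (G.mem_neighborFinset a c).symm) X

namespace Circ

variable (h : Circ G)
include h

lemma two_le_slack {X : Finset V} (hX : X.Nonempty) : 2 ≤ slack G X := by
  by_cases hu : X = Finset.univ
  · rw [hu, h.total]
  · have := h.sparse X hX hu
    omega

lemma eq_univ {X : Finset V} (hX : X.Nonempty) (hs : slack G X < 4) : X = Finset.univ := by
  by_contra hu
  have := h.sparse X hX hu
  omega

lemma three_le_degree (a : V) : 3 ≤ G.degree a := by
  have := h.three_le_cnt a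
  rw [cnt_univ] at this
  exact_mod_cast this

/-- Intersecting tight sets that miss a common vertex have a tight union and intersection, and
no edges join their differences. -/
lemma tight_union {X Y : Finset V} (hX : Tight G X) (hY : Tight G Y) {c w : V}
    (hcX : c ∈ X) (hcY : c ∈ Y) (hwX : w ∉ X) (hwY : w ∉ Y) :
    Tight G (X ∪ Y) ∧ cnt G (X \ Y) (Y \ X) = 0 := by
  have h1 := slack_union_add_inter G X Y
  have hu : X ∪ Y ≠ Finset.univ := ne_univ_of_notMem (a := w) (by simp [hwX, hwY])
  have h2 := h.sparse (X ∪ Y) ⟨c, by simp [hcX]⟩ hu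
  have h3 := h.sparse (X ∩ Y) ⟨c, by simp [hcX, hcY]⟩ (ne_univ_of_notMem (a := w) (by simp [hwX]))
  have h4 := cnt_nonneg G (X \ Y) (Y \ X)
  rw [hX.2, hY.2] at h1
  exact ⟨⟨hu, by omega⟩, by omega⟩

lemma two_le_cnt_of_tight {Z : Finset V} (hZ : Tight G Z) {a b : V} (ha : a ∈ Z) (hb : b ∈ Z)
    (hab : b ≠ a) : 2 ≤ cnt G {a} Z := by
  have h1 := slack_erase G ha
  have h2 := h.sparse (Z.erase a) ⟨b, by simp [hb, hab]⟩ (ne_univ_of_notMem (a := a) (by simp))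
  rw [hZ.2] at h1
  omega

omit h in
lemma tight_erase {Z : Finset V} (hZ : Tight G Z) {a : V} (ha : a ∈ Z) (hc : cnt G {a} Z = 2) :
    Tight G (Z.erase a) := by
  have h1 := slack_erase G ha
  rw [hZ.2, hc] at h1
  exact ⟨ne_univ_of_notMem (a := a) (by simp), by omega⟩

/-- Adding to a tight set a vertex with `k` neighbours in it gives slack `8 - 2k`. This lemma and
the next two read off what the circuit conditions say about `k`. -/
lemma tight_insert {Z : Finset V} (hZ : Tight G Z) {a : V} (ha : a ∉ Z) (hc : 2 ≤ cnt G {a} Z)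
    (hu : insert a Z ≠ Finset.univ) : Tight G (insert a Z) := by
  have h1 := slack_insert G ha
  have h2 := h.sparse (insert a Z) ⟨a, by simp⟩ hu
  rw [hZ.2] at h1
  exact ⟨hu, by omega⟩

lemma cnt_le_three_of_tight {Z : Finset V} (hZ : Tight G Z) {a : V} (ha : a ∉ Z) :
    cnt G {a} Z ≤ 3 := by
  have h1 := slack_insert G ha
  have h2 := h.two_le_slack (X := insert a Z) ⟨a, by simp⟩
  rw [hZ.2] at h1
  omega

lemma insert_eq_univ {Z : Finset V} (hZ : Tight G Z) {a : V} (ha : a ∉ Z)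
    (hc : 3 ≤ cnt G {a} Z) : insert a Z = Finset.univ := by
  have h1 := slack_insert G ha
  rw [hZ.2] at h1
  exact h.eq_univ ⟨a, by simp⟩ (by omega)

/-- A tight set containing a node and some other vertex, but not all neighbours of the node,
contains exactly two of them. -/
lemma tight_node {w s : V} (hw : G.degree w = 3) {Z : Finset V} (hZ : Tight G Z) (hwZ : w ∈ Z)
    {b : V} (hb : b ∈ Z) (hbw : b ≠ w) (hs : G.Adj w s) (hsZ : s ∉ Z) :
    cnt G {w} Z = 2 ∧ ∀ r, G.Adj w r → r ≠ s → r ∈ Z := by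
  have h1 := h.two_le_cnt_of_tight hZ hwZ hb hbw
  rw [cnt_neighborFinset] at h1 ⊢
  have hsN : s ∈ G.neighborFinset w := by simpa using hs
  have hsub : G.neighborFinset w ∩ Z ⊆ (G.neighborFinset w).erase s := by
    intro r hr
    simp only [Finset.mem_inter] at hr
    exact Finset.mem_erase.2 ⟨fun he => hsZ (he ▸ hr.2), hr.1⟩
  have hc : ((G.neighborFinset w).erase s).card = 2 := by
    rw [Finset.card_erase_of_mem hsN, G.card_neighborFinset_eq_degree, hw]
  have heq := Finset.eq_of_subset_of_card_le hsub (by omega)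
  refine ⟨by rw [heq, hc]; rfl, fun r hr hrs => ?_⟩
  have : r ∈ (G.neighborFinset w).erase s := Finset.mem_erase.2 ⟨hrs, by simpa using hr⟩
  rw [← heq] at this
  exact (Finset.mem_inter.1 this).2

end Circ

/-- A circuit to which no inverse of a `K₄⁻`-extension or of a generalised vertex split applies,
and which is neither `K₅ - e` nor `H₁`. -/
structure Irreducible (G : SimpleGraph V) [DecidableRel G.Adj] : Prop where
  circ : Circ G
  contract : ∀ u v x, G.Adj u v → G.Adj u x → x ≠ v → (∀ c, G.Adj u c → G.Adj v c → c = x) →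
    ∃ Z, Tight G Z ∧ u ∈ Z ∧ v ∈ Z ∧ x ∉ Z
  k4Minus : ∀ u₁ u₂ v₁ v₂, v₁ ≠ v₂ → (∀ c, G.Adj u₁ c ↔ c = u₂ ∨ c = v₁ ∨ c = v₂) →
    (∀ c, G.Adj u₂ c ↔ c = u₁ ∨ c = v₁ ∨ c = v₂) → G.Adj v₁ v₂
  not_K5e : IsEmpty (G ≃g K5e)
  not_H1 : IsEmpty (G ≃g H1)

lemma exists_neighbors {w : V} (hw : G.degree w = 3) :
    ∃ x y z, x ≠ y ∧ x ≠ z ∧ y ≠ z ∧ ∀ c, G.Adj w c ↔ c = x ∨ c = y ∨ c = z := by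
  rw [← G.card_neighborFinset_eq_degree, Finset.card_eq_three] at hw
  obtain ⟨x, y, z, hxy, hxz, hyz, hN⟩ := hw
  refine ⟨x, y, z, hxy, hxz, hyz, fun c => ?_⟩
  rw [← G.mem_neighborFinset, hN]
  simp

/-- The neighbours of `w` are pairwise adjacent. -/
def CliqueNode (G : SimpleGraph V) (w : V) : Prop :=
  ∀ a b, G.Adj w a → G.Adj w b → a ≠ b → G.Adj a b

/-- The neighbours of `w` are pairwise nonadjacent. -/
def IndepNode (G : SimpleGraph V) (w : V) : Prop :=
  ∀ a b, G.Adj w a → G.Adj w b → ¬ G.Adj a b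

lemma CliqueNode.not_indepNode {w v : V} (hw : G.degree w = 3) (h : CliqueNode G w)
    (hwv : G.Adj w v) : ¬ IndepNode G v := by
  obtain ⟨x, y, z, hxy, hxz, hyz, hN⟩ := exists_neighbors hw
  intro hi
  obtain ⟨t, ht, htv⟩ : ∃ t, G.Adj w t ∧ t ≠ v := by
    by_cases hxv : x = v
    · exact ⟨y, by simp [hN], fun hyv => hxy (hxv.trans hyv.symm)⟩
    · exact ⟨x, by simp [hN], hxv⟩
  exact hi w t hwv.symm (h v t hwv ht htv.symm) ht

namespace Irreducible

variable (h : Irreducible G)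
include h

/-- A tight set blocking the contraction of `wx` with `wz` dropped also contains `y`. Thus `z` has
the three neighbours `w`, `x`, `y` in it and completes it to `V`, so `z` is a node, and only the
edge `xy` can block the inverse `K₄⁻`-extension at `w`, `z`. -/
lemma no_path_neighborhood {w x y z : V} (hw : G.degree w = 3)
    (hN : ∀ c, G.Adj w c ↔ c = x ∨ c = y ∨ c = z) (hxy : x ≠ y) (hxz : x ≠ z) (hyz : y ≠ z)
    (axz : G.Adj x z) (ayz : G.Adj y z) : G.Adj x y := by
  by_contra naxy
  have hwx : G.Adj w x := by simp [hN]
  have hwy : G.Adj w y := by simp [hN]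
  have hwz : G.Adj w z := by simp [hN]
  obtain ⟨Z, hZ, hwZ, hxZ, hzZ⟩ := h.contract w x z hwx hwz hxz.symm (by
    intro c hc hxc
    rcases (hN c).1 hc with rfl | rfl | rfl
    · exact absurd hxc (G.irrefl)
    · exact absurd hxc naxy
    · rfl)
  have hyZ := (h.circ.tight_node hw hZ hwZ hxZ hwx.ne' hwz hzZ).2 y hwy hyz
  have hsub : ({w, x, y} : Finset V) ⊆ Z.filter (G.Adj z) := by
    intro c hc
    simp only [Finset.mem_insert, Finset.mem_singleton] at hc
    rcases hc with rfl | rfl | rfl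
    · simp [hwZ, hwz.symm]
    · simp [hxZ, axz.symm]
    · simp [hyZ, ayz.symm]
  have hcard : ({w, x, y} : Finset V).card = 3 :=
    Finset.card_eq_three.2 ⟨w, x, y, hwx.ne, hwy.ne, hxy, rfl⟩
  have hle := h.circ.cnt_le_three_of_tight hZ hzZ
  rw [cnt_singleton] at hle
  have heq := Finset.eq_of_subset_of_card_le hsub (by rw [hcard]; exact_mod_cast hle)
  have huniv := h.circ.insert_eq_univ hZ hzZ (by rw [cnt_singleton, ← heq, hcard]; rfl)
  refine naxy (h.k4Minus w z x y hxy (fun c => by rw [hN]; tauto) fun c => ⟨fun hc => ?_, ?_⟩)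
  · have hcZ : c ∈ Z := by
      have : c ∈ insert z Z := by rw [huniv]; simp
      exact (Finset.mem_insert.1 this).resolve_left hc.ne'
    have : c ∈ Z.filter (G.Adj z) := by simp [hcZ, hc]
    rw [← heq] at this
    simpa using this
  · rintro (rfl | rfl | rfl)
    exacts [hwz.symm, axz.symm, ayz.symm]

/-- The sets blocking `wx` with `wy` dropped, and `wy` with `wx` dropped, both contain `z`. Without
`w` they are still tight, meet in `z` and miss `w`, so no edge joins their differences; but `xy`
does. -/
lemma no_single_edge_neighborhood {w x y z : V} (hw : G.degree w = 3)
    (hN : ∀ c, G.Adj w c ↔ c = x ∨ c = y ∨ c = z) (hxy : x ≠ y) (hxz : x ≠ z) (hyz : y ≠ z)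
    (axy : G.Adj x y) (naxz : ¬ G.Adj x z) (nayz : ¬ G.Adj y z) : False := by
  have hwx : G.Adj w x := by simp [hN]
  have hwy : G.Adj w y := by simp [hN]
  have hwz : G.Adj w z := by simp [hN]
  obtain ⟨Z, hZ, hwZ, hxZ, hyZ⟩ := h.contract w x y hwx hwy hxy.symm (by
    intro c hc hxc
    rcases (hN c).1 hc with rfl | rfl | rfl
    · exact absurd hxc (G.irrefl)
    · rfl
    · exact absurd hxc naxz)
  obtain ⟨Z', hZ', hwZ', hyZ', hxZ'⟩ := h.contract w y x hwy hwx hxy (by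
    intro c hc hyc
    rcases (hN c).1 hc with rfl | rfl | rfl
    · rfl
    · exact absurd hyc (G.irrefl)
    · exact absurd hyc nayz)
  obtain ⟨c1, m1⟩ := h.circ.tight_node hw hZ hwZ hxZ hwx.ne' hwy hyZ
  obtain ⟨c2, m2⟩ := h.circ.tight_node hw hZ' hwZ' hyZ' hwy.ne' hwx hxZ'
  have t1 := Circ.tight_erase hZ hwZ c1
  have t2 := Circ.tight_erase hZ' hwZ' c2
  have := (h.circ.tight_union t1 t2 (c := z) (w := w) (by simp [hwz.ne', m1 z hwz hyz.symm])
    (by simp [hwz.ne', m2 z hwz hxz.symm]) (by simp) (by simp)).2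
  have h2 := cnt_pos G (X := Z.erase w \ Z'.erase w) (Y := Z'.erase w \ Z.erase w)
    (a := x) (b := y) (by simp [hwx.ne', hxZ, hxZ']) (by simp [hwy.ne', hyZ, hyZ']) axy
  omega

lemma cliqueNode_or_indepNode {w : V} (hw : G.degree w = 3) :
    CliqueNode G w ∨ IndepNode G w := by
  obtain ⟨x, y, z, hxy, hxz, hyz, hN⟩ := exists_neighbors hw
  have hN2 : ∀ c, G.Adj w c ↔ c = x ∨ c = z ∨ c = y := fun c => by rw [hN]; tauto
  have hN3 : ∀ c, G.Adj w c ↔ c = y ∨ c = z ∨ c = x := fun c => by rw [hN]; tauto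
  have p1 := h.no_path_neighborhood hw hN hxy hxz hyz
  have p2 := h.no_path_neighborhood hw hN2 hxz hxy hyz.symm
  have p3 := h.no_path_neighborhood hw hN3 hyz hxy.symm hxz.symm
  have s1 := h.no_single_edge_neighborhood hw hN hxy hxz hyz
  have s2 := h.no_single_edge_neighborhood hw hN2 hxz hxy hyz.symm
  have s3 := h.no_single_edge_neighborhood hw hN3 hyz hxy.symm hxz.symm
  rw [G.adj_comm z y] at p2 s2
  rw [G.adj_comm y x, G.adj_comm z x] at p3 s3
  by_cases a1 : G.Adj x y <;> by_cases a2 : G.Adj x z <;> by_cases a3 : G.Adj y z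
  · left
    intro a b ha hb hab
    rw [hN] at ha hb
    clear p1 p2 p3 s1 s2 s3
    rcases ha with rfl | rfl | rfl <;> rcases hb with rfl | rfl | rfl <;>
      first | exact absurd rfl hab | assumption | (apply SimpleGraph.Adj.symm; assumption)
  · exact absurd (p3 a1 a2) a3
  · exact absurd (p2 a1 a3) a2
  · exact (s1 a1 a2 a3).elim
  · exact absurd (p1 a2 a3) a1
  · exact (s2 a2 a1 a3).elim
  · exact (s3 a3 a1 a2).elim
  clear p1 p2 p3 s1 s2 s3
  right
  intro a b ha hb
  rw [hN] at ha hb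
  rcases ha with rfl | rfl | rfl <;> rcases hb with rfl | rfl | rfl <;>
    first | exact G.irrefl | assumption | (rw [G.adj_comm]; assumption)

/-- At an independent node no common neighbour hinders a contraction. The blocking set contains
exactly two neighbours of `w`, so it stays tight when `w` is removed. -/
lemma exists_tight_of_indepNode {w s : V} (hw : G.degree w = 3) (hi : IndepNode G w)
    (hs : G.Adj w s) : ∃ X, Tight G X ∧ w ∉ X ∧ s ∉ X ∧ ∀ r, G.Adj w r → r ≠ s → r ∈ X := by
  obtain ⟨r, hr, hrs⟩ : ∃ r, G.Adj w r ∧ r ≠ s := by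
    obtain ⟨x, y, z, hxy, hxz, hyz, hN⟩ := exists_neighbors hw
    by_cases hxs : x = s
    · exact ⟨y, by simp [hN], fun hys => hxy (hxs.trans hys.symm)⟩
    · exact ⟨x, by simp [hN], hxs⟩
  obtain ⟨Z, hZ, hwZ, hrZ, hsZ⟩ := h.contract w r s hr hs hrs.symm
    fun c hc hrc => absurd hrc (hi r c hr hc)
  obtain ⟨hc, hm⟩ := h.circ.tight_node hw hZ hwZ hrZ hr.ne' hs hsZ
  refine ⟨Z.erase w, Circ.tight_erase hZ hwZ hc, by simp, by simp [hsZ], fun t ht hts => ?_⟩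
  simp [ht.ne', hm t ht hts]

end Irreducible

end Tight

/-! ### `K₄`s around clique nodes -/

section Cliques

variable {V : Type u} [Fintype V] [DecidableEq V] {G : SimpleGraph V} [DecidableRel G.Adj]

omit [Fintype V] [DecidableEq V] [DecidableRel G.Adj] in
lemma nonempty_iso_of_fin {n : ℕ} {H : SimpleGraph (Fin n)} (f : Fin n → V)
    (hinj : ∀ i j, i < j → f i ≠ f j) (hsurj : ∀ c, ∃ i, f i = c)
    (hadj : ∀ i j, i < j → (G.Adj (f i) (f j) ↔ H.Adj i j)) : Nonempty (G ≃g H) := by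
  have hb : Function.Bijective f := by
    refine ⟨fun i j hij => ?_, hsurj⟩
    rcases lt_trichotomy i j with hlt | heq | hlt
    · exact (hinj i j hlt hij).elim
    · exact heq
    · exact (hinj j i hlt hij.symm).elim
  have key : ∀ i j, G.Adj (f i) (f j) ↔ H.Adj i j := by
    intro i j
    rcases lt_trichotomy i j with hlt | rfl | hlt
    · exact hadj i j hlt
    · simp
    · rw [G.adj_comm, H.adj_comm]
      exact hadj j i hlt
  exact ⟨(⟨Equiv.ofBijective f hb, fun {i j} => key i j⟩ : H ≃g G).symm⟩

lemma H1_adj (i j : Fin 6) : H1.Adj i j ↔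
    i ≠ j ∧ ¬ ((i = 1 ∨ i = 2) ∧ (j = 4 ∨ j = 5)) ∧ ¬ ((j = 1 ∨ j = 2) ∧ (i = 4 ∨ i = 5)) := by
  simp only [H1, SimpleGraph.fromEdgeSet_adj, Set.mem_insert_iff, Set.mem_singleton_iff]
  revert i j
  decide

lemma nonempty_iso_H1 {a w q p w' q' : V} (haw : G.Adj a w) (haq : G.Adj a q) (hap : G.Adj a p)
    (haw' : G.Adj a w') (haq' : G.Adj a q') (hwq : G.Adj w q) (hwp : G.Adj w p)
    (hqp : G.Adj q p) (hpw' : G.Adj p w') (hpq' : G.Adj p q') (hwq' : G.Adj w' q')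
    (nww : ¬ G.Adj w w') (nwq : ¬ G.Adj w q') (nqw : ¬ G.Adj q w') (nqq : ¬ G.Adj q q')
    (dww : w ≠ w') (dwq : w ≠ q') (dqw : q ≠ w') (dqq : q ≠ q')
    (hsurj : ∀ c, c = a ∨ c = w ∨ c = q ∨ c = p ∨ c = w' ∨ c = q') : Nonempty (G ≃g H1) := by
  refine nonempty_iso_of_fin ![a, w, q, p, w', q'] ?_ ?_ ?_
  · intro i j hij
    fin_cases i <;> fin_cases j <;> first
      | exact absurd hij (by decide)
      | exact haw.ne | exact haq.ne | exact hap.ne | exact haw'.ne | exact haq'.ne | exact hwq.ne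
      | exact hwp.ne | exact hqp.ne | exact hpw'.ne | exact hpq'.ne | exact hwq'.ne
      | exact dww | exact dwq | exact dqw | exact dqq
  · intro c
    rcases hsurj c with rfl | rfl | rfl | rfl | rfl | rfl
    exacts [⟨0, rfl⟩, ⟨1, rfl⟩, ⟨2, rfl⟩, ⟨3, rfl⟩, ⟨4, rfl⟩, ⟨5, rfl⟩]
  · intro i j hij
    rw [H1_adj]
    fin_cases i <;> fin_cases j <;> first
      | exact absurd hij (by decide)
      | exact iff_of_true haw (by decide)
      | exact iff_of_true haq (by decide)
      | exact iff_of_true hap (by decide)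
      | exact iff_of_true haw' (by decide)
      | exact iff_of_true haq' (by decide)
      | exact iff_of_true hwq (by decide)
      | exact iff_of_true hwp (by decide)
      | exact iff_of_true hqp (by decide)
      | exact iff_of_true hpw' (by decide)
      | exact iff_of_true hpq' (by decide)
      | exact iff_of_true hwq' (by decide)
      | exact iff_of_false nww (by decide)
      | exact iff_of_false nwq (by decide)
      | exact iff_of_false nqw (by decide)
      | exact iff_of_false nqq (by decide)

lemma slack_clique {K : Finset V} (hK : ∀ a ∈ K, ∀ b ∈ K, a ≠ b → G.Adj a b) :
    slack G K = K.card * (5 - K.card) := by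
  unfold slack
  rw [cnt_clique G hK]
  ring

namespace Circ

variable (h : Circ G)
include h

lemma tight_of_clique {K : Finset V} (hK : ∀ a ∈ K, ∀ b ∈ K, a ≠ b → G.Adj a b)
    (hc : K.card = 4) : Tight G K := by
  have h1 := slack_clique hK
  rw [hc] at h1
  norm_num at h1
  refine ⟨fun hu => ?_, h1⟩
  have h2 := h.total
  rw [hu] at h1
  omega

/-- Two or three vertices of a `K₄` have slack 6, so the union has slack `4 + 4 - 6 - 2d`, with `d`
the number of edges between the differences. Slack is at least 2, whence `d = 0`. -/
lemma tight_meets_clique {K : Finset V} (hK : ∀ a ∈ K, ∀ b ∈ K, a ≠ b → G.Adj a b)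
    (hc : K.card = 4) {Z : Finset V} (hZ : Tight G Z) {a b p : V} (ha : a ∈ Z) (haK : a ∈ K)
    (hb : b ∈ Z) (hbK : b ∈ K) (hab : a ≠ b) (hp : p ∉ Z) (hpK : p ∈ K) :
    Z ∪ K = Finset.univ ∧ cnt G (Z \ K) (K \ Z) = 0 := by
  have h1 := slack_union_add_inter G Z K
  have h2 := h.two_le_slack (X := Z ∪ K) ⟨a, by simp [ha]⟩
  have h3 := cnt_nonneg G (Z \ K) (K \ Z)
  have h4 : slack G (Z ∩ K) = 6 := by
    rw [slack_clique fun a ha b hb => hK a (Finset.mem_inter.1 ha).2 b (Finset.mem_inter.1 hb).2]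
    have l1 : 1 < (Z ∩ K).card :=
      Finset.one_lt_card.2 ⟨a, by simp [ha, haK], b, by simp [hb, hbK], hab⟩
    have l2 : (Z ∩ K).card < K.card := Finset.card_lt_card
      ⟨Finset.inter_subset_right, fun hs => hp (Finset.mem_inter.1 (hs hpK)).1⟩
    rw [hc] at l2
    interval_cases (Z ∩ K).card <;> norm_num
  rw [hZ.2, (h.tight_of_clique hK hc).2, h4] at h1
  exact ⟨h.eq_univ ⟨a, by simp [ha]⟩ (by omega), by omega⟩

/-- Deleting the triangle removes 3 vertices and 6 edges, which leaves the slack at 2, too small for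
a nonempty proper set. -/
lemma no_triangle_of_nodes {a b c : V} (ha : G.degree a = 3) (hb : G.degree b = 3)
    (hc : G.degree c = 3) (hab : G.Adj a b) (hac : G.Adj a c) (hbc : G.Adj b c) : False := by
  have ce : ∀ (w p : V) (X : Finset V), p ∈ X → G.Adj w p →
      cnt G {w} (X.erase p) = cnt G {w} X - 1 := by
    intro w p X hp hwp
    have hpf : p ∈ X.filter (G.Adj w) := by simp [hp, hwp]
    rw [cnt_singleton, cnt_singleton, Finset.filter_erase, Finset.card_erase_of_mem hpf,
      Nat.cast_sub (Finset.card_pos.2 ⟨p, hpf⟩)]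
    rfl
  have m1 : b ∈ Finset.univ.erase a := by simp [hab.ne']
  have m2 : c ∈ Finset.univ.erase a := by simp [hac.ne']
  have m3 : c ∈ (Finset.univ.erase a).erase b := by simp [hac.ne', hbc.ne']
  have s1 := slack_erase G (Finset.mem_univ a)
  have s2 := slack_erase G m1
  have s3 := slack_erase G m3
  rw [ce b a _ (Finset.mem_univ a) hab.symm] at s2
  rw [ce c b _ m1 hbc.symm, ce c a _ (Finset.mem_univ a) hac.symm] at s3
  rw [cnt_univ] at s1 s2 s3
  rw [ha, h.total] at s1
  rw [hb, s1] at s2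
  rw [hc, s2] at s3
  have hne : (((Finset.univ.erase a).erase b).erase c).Nonempty := by
    obtain ⟨x, y, z, hxy, hxz, hyz, hN⟩ := exists_neighbors ha
    have : ∃ p, G.Adj a p ∧ p ≠ b ∧ p ≠ c := by
      by_contra! hall
      have hx := hall x (by simp [hN])
      have hy := hall y (by simp [hN])
      have hz := hall z (by simp [hN])
      grind
    obtain ⟨p, hp, hpb, hpc⟩ := this
    exact ⟨p, by simp [hp.ne', hpb, hpc]⟩
  have := h.sparse _ hne (ne_univ_of_notMem (a := c) (by simp))
  norm_num at s3
  omega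

end Circ

lemma exists_other_neighbors {w a : V} (hw : G.degree w = 3) (ha : G.Adj w a) :
    ∃ x y, a ≠ x ∧ a ≠ y ∧ x ≠ y ∧ ∀ c, G.Adj w c ↔ c = a ∨ c = x ∨ c = y := by
  obtain ⟨x, y, z, hxy, hxz, hyz, hN⟩ := exists_neighbors hw
  rcases (hN a).1 ha with rfl | rfl | rfl
  · exact ⟨y, z, hxy, hxz, hyz, hN⟩
  · exact ⟨x, z, hxy.symm, hyz, hxz, fun c => by rw [hN]; tauto⟩
  · exact ⟨x, y, hxz.symm, hyz.symm, hxy, fun c => by rw [hN]; tauto⟩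

/-- The closed neighbourhood of a vertex. -/
def nbhd (G : SimpleGraph V) [DecidableRel G.Adj] (w : V) : Finset V :=
  insert w (G.neighborFinset w)

lemma mem_nbhd {w c : V} : c ∈ nbhd G w ↔ c = w ∨ G.Adj w c := by simp [nbhd]

lemma card_nbhd {w : V} (hw : G.degree w = 3) : (nbhd G w).card = 4 := by
  rw [nbhd, Finset.card_insert_of_notMem (by simp), G.card_neighborFinset_eq_degree, hw]

lemma CliqueNode.adj_nbhd {w : V} (hq : CliqueNode G w) :
    ∀ a ∈ nbhd G w, ∀ b ∈ nbhd G w, a ≠ b → G.Adj a b := by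
  intro a ha b hb hab
  rw [mem_nbhd] at ha hb
  rcases ha with rfl | ha <;> rcases hb with rfl | hb
  · exact absurd rfl hab
  · exact hb
  · exact ha.symm
  · exact hq a b ha hb hab

lemma nbhd_eq_of_mem {w a : V} (hw : G.degree w = 3) (hq : CliqueNode G w) (ha : a ∈ nbhd G w)
    (hd : G.degree a = 3) : nbhd G a = nbhd G w := by
  symm
  refine Finset.eq_of_subset_of_card_le (fun b hb => ?_) (by rw [card_nbhd hw, card_nbhd hd])
  rw [mem_nbhd]
  by_cases hba : b = a
  · exact Or.inl hba
  · exact Or.inr (hq.adj_nbhd a ha b hb (Ne.symm hba))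

lemma exists_neighbor_outside {w a : V} (hw : G.degree w = 3) (ha : a ∈ nbhd G w)
    (hd : 4 ≤ G.degree a) : ∃ b, G.Adj a b ∧ b ∉ nbhd G w := by
  by_contra! hall
  have hsub : G.neighborFinset a ⊆ (nbhd G w).erase a := by
    intro b hb
    rw [G.mem_neighborFinset] at hb
    exact Finset.mem_erase.2 ⟨hb.ne', hall b hb⟩
  have := Finset.card_le_card hsub
  rw [G.card_neighborFinset_eq_degree, Finset.card_erase_of_mem ha, card_nbhd hw] at this
  omega

namespace Irreducible

variable (h : Irreducible G)
include h

/-- With three neighbours in a tight `K₄`, `b` completes it to `V`, and the graph is `K5e`. -/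
lemma no_outside_neighbor_of_three {w x y z b : V} (hw : G.degree w = 3) (hq : CliqueNode G w)
    (hxy : x ≠ y) (hxz : x ≠ z) (hyz : y ≠ z) (hN : ∀ c, G.Adj w c ↔ c = x ∨ c = y ∨ c = z)
    (hbw : b ≠ w) (bx : G.Adj b x) (hby : G.Adj b y) (bz : G.Adj b z) : False := by
  have hwx : G.Adj w x := by simp [hN]
  have hwy : G.Adj w y := by simp [hN]
  have hwz : G.Adj w z := by simp [hN]
  have hK := hq.adj_nbhd
  have nwb : ¬ G.Adj w b := by
    rw [hN]
    rintro (rfl | rfl | rfl)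
    exacts [G.irrefl bx, G.irrefl hby, G.irrefl bz]
  have hbK : b ∉ nbhd G w := by rw [mem_nbhd]; tauto
  have hu : insert b (nbhd G w) = Finset.univ := by
    refine h.circ.insert_eq_univ (h.circ.tight_of_clique hK (card_nbhd hw)) hbK ?_
    have hc : ({x, y, z} : Finset V).card = 3 :=
      Finset.card_eq_three.2 ⟨x, y, z, hxy, hxz, hyz, rfl⟩
    rw [cnt_singleton, ← Nat.cast_ofNat, ← hc, Nat.cast_le]
    refine Finset.card_le_card fun c hcm => ?_
    simp only [Finset.mem_insert, Finset.mem_singleton] at hcm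
    rcases hcm with rfl | rfl | rfl <;> simp [mem_nbhd, *]
  -- The missing edge of `K5e` joins 2 and 4, so the nonadjacent `w` and `b` take these places.
  refine (not_isEmpty_iff.2 (nonempty_iso_of_fin (H := K5e) ![x, y, w, z, b] ?_ ?_ ?_)) h.not_K5e
  · intro i j hij
    fin_cases i <;> fin_cases j <;>
      simp_all [hwx.ne', hwy.ne', hwz.ne, bx.ne', hby.ne', bz.ne', hbw.symm]
  · intro c
    have hc : c ∈ insert b (nbhd G w) := by rw [hu]; simp
    rw [Finset.mem_insert, mem_nbhd, hN] at hc
    rcases hc with rfl | rfl | rfl | rfl | rfl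
    exacts [⟨4, rfl⟩, ⟨2, rfl⟩, ⟨0, rfl⟩, ⟨1, rfl⟩, ⟨3, rfl⟩]
  · have axy := hq x y hwx hwy hxy
    have axz := hq x z hwx hwz hxz
    have ayz := hq y z hwy hwz hyz
    intro i j hij
    fin_cases i <;> fin_cases j <;>
      first
        | (exfalso; revert hij; decide)
        | simp [K5e, axy, axz, ayz, hwx.symm, hwy.symm, hwz, bx.symm, hby.symm, bz.symm, nwb]

/-- As `b` is adjacent to neither `w` nor `y`, a tight set blocks contracting `ab` with `ax`
dropped. It contains two neighbours of `a`, hence a second vertex of the `K₄`, and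
`tight_meets_clique` forbids the edge from `x` to a vertex outside the `K₄`. -/
lemma no_degree_four_aux {w a x y b : V} (hw : G.degree w = 3) (hq : CliqueNode G w)
    (hax : a ≠ x) (hay : a ≠ y) (hxy : x ≠ y) (hN : ∀ c, G.Adj w c ↔ c = a ∨ c = x ∨ c = y)
    (ha : G.degree a = 4) (hx : 4 ≤ G.degree x) (hab : G.Adj a b) (hb : b ∉ nbhd G w)
    (nby : ¬ G.Adj b y) : False := by
  have hwa : G.Adj w a := by simp [hN]
  have hwx : G.Adj w x := by simp [hN]
  have hwy : G.Adj w y := by simp [hN]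
  have aax := hq a x hwa hwx hax
  have aay := hq a y hwa hwy hay
  have hb' := hb
  rw [mem_nbhd, not_or, hN] at hb'
  push Not at hb'
  obtain ⟨hbw, -, hbx, hby⟩ := hb'
  have nwb : ¬ G.Adj w b := fun hc => hb (mem_nbhd.2 (Or.inr hc))
  have hNa : ({w, x, y, b} : Finset V) = G.neighborFinset a := by
    refine Finset.eq_of_subset_of_card_le (fun c hc => ?_) ?_
    · simp only [Finset.mem_insert, Finset.mem_singleton] at hc
      rw [G.mem_neighborFinset]
      rcases hc with rfl | rfl | rfl | rfl
      exacts [hwa.symm, aax, aay, hab]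
    · rw [G.card_neighborFinset_eq_degree, ha, Finset.card_insert_of_notMem,
        Finset.card_insert_of_notMem, Finset.card_insert_of_notMem, Finset.card_singleton]
      · simpa using hby.symm
      · simp [hxy, hbx.symm]
      · simp [hwx.ne, hwy.ne, hbw.symm]
  have hNa' : ∀ c, G.Adj a c → c = w ∨ c = x ∨ c = y ∨ c = b := by
    intro c hc
    rw [← G.mem_neighborFinset, ← hNa] at hc
    simpa using hc
  obtain ⟨Z, hZ, haZ, hbZ, hxZ⟩ := h.contract a b x hab aax hbx.symm (by
    intro c hac hbc
    rcases hNa' c hac with rfl | rfl | rfl | rfl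
    · exact absurd hbc.symm nwb
    · rfl
    · exact absurd hbc nby
    · exact absurd hbc G.irrefl)
  have h2 := h.circ.two_le_cnt_of_tight hZ haZ hbZ hab.ne'
  have hK := hq.adj_nbhd
  obtain ⟨t, htZ, htK, hta⟩ : ∃ t, t ∈ Z ∧ t ∈ nbhd G w ∧ a ≠ t := by
    by_contra! hall
    have hsub : Z.filter (G.Adj a) ⊆ {b} := by
      intro c hc
      rw [Finset.mem_filter] at hc
      rw [Finset.mem_singleton]
      rcases hNa' c hc.2 with rfl | rfl | rfl | rfl
      · exact absurd (hall c hc.1 (by simp [mem_nbhd])) hwa.ne'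
      · exact absurd hc.1 hxZ
      · exact absurd (hall c hc.1 (by simp [mem_nbhd, hwy])) hay
      · rfl
    have := Finset.card_le_card hsub
    rw [cnt_singleton] at h2
    rw [Finset.card_singleton] at this
    omega
  have hxK : x ∈ nbhd G w := by simp [mem_nbhd, hwx]
  obtain ⟨hu, h0⟩ := h.circ.tight_meets_clique hK (card_nbhd hw) hZ haZ
    (by simp [mem_nbhd, hwa]) htZ htK hta hxZ hxK
  obtain ⟨c, hxc, hcK⟩ := exists_neighbor_outside hw hxK hx
  have hcZ : c ∈ Z := by
    have : c ∈ Z ∪ nbhd G w := by rw [hu]; simp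
    exact (Finset.mem_union.1 this).resolve_right hcK
  have := cnt_pos G (X := Z \ nbhd G w) (Y := nbhd G w \ Z) (a := c) (b := x)
    (by simp [hcZ, hcK]) (by simp [hxZ, hxK]) hxc.symm
  omega

/-- A vertex of degree at least four adjacent to a node in a `K₄` has degree at least five. -/
lemma five_le_degree {w a : V} (hw : G.degree w = 3) (hq : CliqueNode G w) (hwa : G.Adj w a)
    (ha : G.degree a ≠ 3) : 5 ≤ G.degree a := by
  have h3 := h.circ.three_le_degree a
  by_contra! hlt
  have ha4 : G.degree a = 4 := by omega
  obtain ⟨x, y, hax, hay, hxy, hN⟩ := exists_other_neighbors hw hwa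
  have hN' : ∀ c, G.Adj w c ↔ c = a ∨ c = y ∨ c = x := fun c => by rw [hN]; tauto
  have hwx : G.Adj w x := by simp [hN]
  have hwy : G.Adj w y := by simp [hN]
  have axy := hq x y hwx hwy hxy
  obtain ⟨b, hab, hb⟩ := exists_neighbor_outside hw (by simp [mem_nbhd, hwa]) ha4.ge
  have inside : ∀ p, G.Adj w p → G.degree p = 3 → ¬ G.Adj b p := by
    intro p hp hd hbp
    apply hb
    rw [← nbhd_eq_of_mem hw hq (mem_nbhd.2 (Or.inr hp)) hd, mem_nbhd]
    exact Or.inr hbp.symm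
  have hx3 := h.circ.three_le_degree x
  have hy3 := h.circ.three_le_degree y
  -- `no_degree_four_aux` needs one of `x`, `y` nonadjacent to `b` and the other a non-node. They
  -- are not both nodes, by the triangle with `w`, and not both adjacent to `b`, as the graph is not
  -- `K5e`.
  by_cases hx : G.degree x = 3
  · have hy : G.degree y ≠ 3 := fun hy => h.circ.no_triangle_of_nodes hw hx hy hwx hwy axy
    exact h.no_degree_four_aux hw hq hay hax hxy.symm hN' ha4 (by omega) hab hb (inside x hwx hx)
  · by_cases hby : G.Adj b y
    · have hy : G.degree y ≠ 3 := fun hy => inside y hwy hy hby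
      refine h.no_degree_four_aux hw hq hay hax hxy.symm hN' ha4 (by omega) hab hb fun hbx => ?_
      exact h.no_outside_neighbor_of_three hw hq hax hay hxy hN
        (fun hbw => hb (mem_nbhd.2 (Or.inl hbw))) hab.symm hbx hby
    · exact h.no_degree_four_aux hw hq hax hay hxy hN ha4 (by omega) hab hb hby

/-- Two `K₄`s containing nodes share at most one vertex. -/
lemma nbhd_eq_of_two_common {w w' a p : V} (hw : G.degree w = 3) (hq : CliqueNode G w)
    (hw' : G.degree w' = 3) (hq' : CliqueNode G w') (hap : a ≠ p) (ha : a ∈ nbhd G w)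
    (hp : p ∈ nbhd G w) (ha' : a ∈ nbhd G w') (hp' : p ∈ nbhd G w') :
    nbhd G w = nbhd G w' := by
  by_contra hne
  have hwK : w ∉ nbhd G w' := fun hm => hne (nbhd_eq_of_mem hw' hq' hm hw)
  have hwK' : w' ∉ nbhd G w := fun hm => hne (nbhd_eq_of_mem hw hq hm hw').symm
  have haw : a ≠ w := fun he => hwK (he ▸ ha')
  have hpw : p ≠ w := fun he => hwK (he ▸ hp')
  have haw' : a ≠ w' := fun he => hwK' (he ▸ ha)
  have hpw' : p ≠ w' := fun he => hwK' (he ▸ hp)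
  have hww' : w ≠ w' := fun he => hwK (by rw [he, mem_nbhd]; simp)
  have hwa : G.Adj w a := (mem_nbhd.1 ha).resolve_left haw
  have hwp : G.Adj w p := (mem_nbhd.1 hp).resolve_left hpw
  have hwa' : G.Adj w' a := (mem_nbhd.1 ha').resolve_left haw'
  have hwp' : G.Adj w' p := (mem_nbhd.1 hp').resolve_left hpw'
  obtain ⟨q, hq1, hq2, hq3, hN⟩ : ∃ q, a ≠ q ∧ p ≠ q ∧ G.Adj w q ∧
      ∀ c, G.Adj w c ↔ c = a ∨ c = p ∨ c = q := by
    obtain ⟨x, y, hax, hay, hxy, hN⟩ := exists_other_neighbors hw hwa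
    rcases (hN p).1 hwp with rfl | rfl | rfl
    · exact absurd rfl hap
    · exact ⟨y, hay, hxy, by simp [hN], hN⟩
    · exact ⟨x, hax, hxy.symm, by simp [hN], fun c => by rw [hN]; tauto⟩
  obtain ⟨q', hq1', hq2', hq3', hN'⟩ : ∃ q, a ≠ q ∧ p ≠ q ∧ G.Adj w' q ∧
      ∀ c, G.Adj w' c ↔ c = a ∨ c = p ∨ c = q := by
    obtain ⟨x, y, hax, hay, hxy, hN⟩ := exists_other_neighbors hw' hwa'
    rcases (hN p).1 hwp' with rfl | rfl | rfl
    · exact absurd rfl hap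
    · exact ⟨y, hay, hxy, by simp [hN], hN⟩
    · exact ⟨x, hax, hxy.symm, by simp [hN], fun c => by rw [hN]; tauto⟩
  -- A third common vertex would make the graph `K5e`. With exactly two, the `K₄`s cover `V` and no
  -- edge joins their differences, which is `H1`.
  have hqw : ¬ G.Adj w' q := fun hc =>
    h.no_outside_neighbor_of_three hw hq hap hq1 hq2 hN hww'.symm hwa' hwp' hc
  have hqw' : ¬ G.Adj w q' := fun hc =>
    h.no_outside_neighbor_of_three hw' hq' hap hq1' hq2' hN' hww' hwa hwp hc
  have hqK : q ∉ nbhd G w' := by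
    rw [mem_nbhd, not_or]
    exact ⟨fun he => hwK' (by rw [mem_nbhd, ← he]; exact Or.inr hq3), hqw⟩
  have hqK' : q' ∉ nbhd G w := by
    rw [mem_nbhd, not_or]
    exact ⟨fun he => hwK (by rw [mem_nbhd, ← he]; exact Or.inr hq3'), hqw'⟩
  have hqm : q ∈ nbhd G w := mem_nbhd.2 (Or.inr hq3)
  have hqm' : q' ∈ nbhd G w' := mem_nbhd.2 (Or.inr hq3')
  have hK := hq.adj_nbhd
  have hK' := hq'.adj_nbhd
  obtain ⟨hu, h0⟩ := h.circ.tight_meets_clique hK' (card_nbhd hw')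
    (h.circ.tight_of_clique hK (card_nbhd hw)) ha ha' hp hp' hap hqK' hqm'
  have nqq : ¬ G.Adj q q' := by
    intro hc
    have := cnt_pos G (X := nbhd G w \ nbhd G w') (Y := nbhd G w' \ nbhd G w)
      (by simp [hqm, hqK]) (by simp [hqm', hqK']) hc
    omega
  have nww : ¬ G.Adj w w' := fun hc => hwK' (mem_nbhd.2 (Or.inr hc))
  have hqq : q ≠ q' := fun he => hqK' (he ▸ hqm)
  have hwq' : w ≠ q' := fun he => hwK (he ▸ hqm')
  have hqw2 : q ≠ w' := fun he => hwK' (he ▸ hqm)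
  have aap := hq a p hwa hwp hap
  have aaq := hq a q hwa hq3 hq1
  have apq := hq p q hwp hq3 hq2
  have aaq' := hq' a q' hwa' hq3' hq1'
  have apq' := hq' p q' hwp' hq3' hq2'
  refine not_isEmpty_iff.2 (nonempty_iso_H1 hwa.symm aaq aap hwa'.symm aaq' hq3 hwp apq.symm
    hwp'.symm apq' hq3' nww hqw' (fun hc => hqw hc.symm) nqq hww' hwq' hqw2 hqq fun c => ?_)
    h.not_H1
  have hc : c ∈ nbhd G w ∪ nbhd G w' := by rw [hu]; simp
  rw [Finset.mem_union, mem_nbhd, mem_nbhd, hN, hN'] at hc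
  rcases hc with (hc | hc | hc | hc) | (hc | hc | hc | hc) <;> simp [hc]

end Irreducible

end Cliques

/-! ### Discharging and the maximal obstruction -/

section Main

variable {V : Type u} [Fintype V] [DecidableEq V] {G : SimpleGraph V} [DecidableRel G.Adj]

lemma sum_degree (G : SimpleGraph V) [DecidableRel G.Adj] (A : Finset V) :
    ∑ a ∈ A, (G.degree a : ℤ) = cnt G A Finset.univ := by
  rw [cnt_eq_sum]
  exact Finset.sum_congr rfl fun a _ => (cnt_univ G a).symm

lemma cnt_univ_right (G : SimpleGraph V) [DecidableRel G.Adj] (A B : Finset V) :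
    cnt G A Finset.univ = cnt G A B + cnt G A Bᶜ := by
  rw [← cnt_union_right G disjoint_compl_right, Finset.union_compl]

lemma cnt_univ_univ (G : SimpleGraph V) [DecidableRel G.Adj] (A : Finset V) :
    cnt G Finset.univ Finset.univ = cnt G A A + 2 * cnt G A Aᶜ + cnt G Aᶜ Aᶜ := by
  have h1 : cnt G Finset.univ Finset.univ = cnt G (A ∪ Aᶜ) Finset.univ := by
    rw [Finset.union_compl]
  rw [h1, cnt_union_left G disjoint_compl_right, cnt_univ_right G A A, cnt_univ_right G Aᶜ A,
    cnt_comm G Aᶜ A]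
  ring

lemma cnt_eq_two {w s : V} (hw : G.degree w = 3) (hs : G.Adj w s) {Y : Finset V} (hsY : s ∉ Y)
    (hY : ∀ r, G.Adj w r → r ≠ s → r ∈ Y) : cnt G {w} Y = 2 := by
  have : G.neighborFinset w ∩ Y = (G.neighborFinset w).erase s := by
    ext r
    simp only [Finset.mem_inter, G.mem_neighborFinset, Finset.mem_erase]
    exact ⟨fun hr => ⟨fun he => hsY (he ▸ hr.2), hr.1⟩, fun hr => ⟨hr.2, hY r hr.2 hr.1⟩⟩
  rw [cnt_neighborFinset, this, Finset.card_erase_of_mem (by simpa using hs),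
    G.card_neighborFinset_eq_degree, hw]
  rfl

lemma cnt_eq_three {w : V} (hw : G.degree w = 3) {Y : Finset V}
    (hY : ∀ r, G.Adj w r → r ∈ Y) : cnt G {w} Y = 3 := by
  have : G.neighborFinset w ∩ Y = G.neighborFinset w :=
    Finset.inter_eq_left.2 fun r hr => hY r (by simpa using hr)
  rw [cnt_neighborFinset, this, G.card_neighborFinset_eq_degree, hw]
  rfl

/-- Since all degrees in `Q` are 3, the complement has slack `2 + 2|Q| - 2e(Q)`, which is at most 2
when `Q` induces minimum degree 2. Consequently a proper set of nodes induces a forest. -/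
lemma Circ.eq_univ_of_nodes (h : Circ G) {Q : Finset V} (hne : Q.Nonempty)
    (hd : ∀ w ∈ Q, G.degree w = 3) (hc : ∀ w ∈ Q, 2 ≤ cnt G {w} Q) : Q = Finset.univ := by
  by_contra hQ
  have hcomp : Qᶜ.Nonempty := by
    rw [Finset.nonempty_iff_ne_empty, Ne, Finset.compl_eq_empty_iff]
    exact hQ
  obtain ⟨q, hq⟩ := hne
  have h1 := h.sparse Qᶜ hcomp (ne_univ_of_notMem (a := q) (by simp [hq]))
  have h2 := cnt_univ_univ G Q
  have h3 := cnt_univ_right G Q Q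
  have h4 := h.total
  rw [← sum_degree, Finset.sum_congr rfl (fun w hw => by rw [hd w hw])] at h3
  have h5 : 2 * (Q.card : ℤ) ≤ cnt G Q Q := by
    rw [cnt_eq_sum]
    have := Finset.card_nsmul_le_sum Q _ 2 hc
    simpa [mul_comm] using this
  have h6 : ((Q.card : ℤ)) + Qᶜ.card = (Finset.univ : Finset V).card := by
    exact_mod_cast Finset.card_add_card_compl Q
  unfold slack at h1 h4
  simp only [Finset.sum_const, nsmul_eq_mul, Nat.cast_ofNat] at h3
  linarith

namespace Irreducible

variable (h : Irreducible G)
include h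

/-- The distinct `K₄`s around these nodes meet pairwise only in `a`, so there are at most `⌊d/3⌋` of
them for `d = deg a`, and each contains at most two nodes adjacent to `a`. If there is any, then `d
≥ 5` and `⌊d/3⌋ ≤ d - 4`. -/
lemma cnt_nodes_le {Q : Finset V} (hQ : ∀ w ∈ Q, G.degree w = 3 ∧ CliqueNode G w) {a : V}
    (ha : G.degree a ≠ 3) : cnt G {a} Q ≤ 2 * ((G.degree a : ℤ) - 4) := by
  rw [cnt_singleton]
  set S := Q.filter (G.Adj a) with hS
  have hSm : ∀ w ∈ S, G.degree w = 3 ∧ CliqueNode G w ∧ G.Adj w a := by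
    intro w hw
    rw [hS, Finset.mem_filter] at hw
    exact ⟨(hQ w hw.1).1, (hQ w hw.1).2, hw.2.symm⟩
  have h3 := h.circ.three_le_degree a
  rcases S.eq_empty_or_nonempty with he | ⟨w₀, hw₀⟩
  · rw [he, Finset.card_empty]
    omega
  have h5 : 5 ≤ G.degree a := by
    obtain ⟨h1, h2, h3⟩ := hSm w₀ hw₀
    exact h.five_le_degree h1 h2 h3 ha
  have hm : S.card ≤ 2 * (S.image (nbhd G)).card := by
    refine Finset.card_le_mul_card_image S 2 fun K hK => ?_
    obtain ⟨w, hw, rfl⟩ := Finset.mem_image.1 hK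
    by_contra! hlt
    obtain ⟨p, q, r, hp, hq, hr, hpq, hpr, hqr⟩ := Finset.two_lt_card_iff.1 hlt
    rw [Finset.mem_filter] at hp hq hr
    have hadj := (hSm w hw).2.1.adj_nbhd
    have mem : ∀ t, nbhd G t = nbhd G w → t ∈ nbhd G w := by
      intro t ht
      rw [← ht, mem_nbhd]
      exact Or.inl rfl
    exact h.circ.no_triangle_of_nodes (hSm p hp.1).1 (hSm q hq.1).1 (hSm r hr.1).1
      (hadj p (mem p hp.2) q (mem q hq.2) hpq) (hadj p (mem p hp.2) r (mem r hr.2) hpr)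
      (hadj q (mem q hq.2) r (mem r hr.2) hqr)
  have hmem : ∀ w ∈ S, a ∈ nbhd G w := fun w hw => mem_nbhd.2 (Or.inr (hSm w hw).2.2)
  have ht : 3 * (S.image (nbhd G)).card ≤ G.degree a := by
    have hdis : ∀ K ∈ S.image (nbhd G), ∀ L ∈ S.image (nbhd G), K ≠ L →
        Disjoint (K.erase a) (L.erase a) := by
      intro K hK L hL hKL
      obtain ⟨w, hw, rfl⟩ := Finset.mem_image.1 hK
      obtain ⟨w', hw', rfl⟩ := Finset.mem_image.1 hL
      rw [Finset.disjoint_left]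
      intro p hp hp'
      rw [Finset.mem_erase] at hp hp'
      exact hKL (h.nbhd_eq_of_two_common (hSm w hw).1 (hSm w hw).2.1 (hSm w' hw').1
        (hSm w' hw').2.1 hp.1.symm (hmem w hw) hp.2 (hmem w' hw') hp'.2)
    have hcard : ((S.image (nbhd G)).biUnion fun K => K.erase a).card =
        ∑ K ∈ S.image (nbhd G), (K.erase a).card := Finset.card_biUnion hdis
    have h3' : ∀ K ∈ S.image (nbhd G), (K.erase a).card = 3 := by
      intro K hK
      obtain ⟨w, hw, rfl⟩ := Finset.mem_image.1 hK
      rw [Finset.card_erase_of_mem (hmem w hw), card_nbhd (hSm w hw).1]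
    rw [Finset.sum_congr rfl h3', Finset.sum_const, smul_eq_mul, mul_comm] at hcard
    rw [← hcard, ← G.card_neighborFinset_eq_degree]
    refine Finset.card_le_card fun p hp => ?_
    obtain ⟨K, hK, hpK⟩ := Finset.mem_biUnion.1 hp
    obtain ⟨w, hw, rfl⟩ := Finset.mem_image.1 hK
    rw [Finset.mem_erase] at hpK
    rw [G.mem_neighborFinset]
    exact (hSm w hw).2.1.adj_nbhd a (hmem w hw) p hpK.2 hpK.1.symm
  omega

/-- If every node of `A` lies in a `K₄` inside `A`, then the degrees in `A` are at least four on
average. -/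
lemma four_mul_card_le {A : Finset V}
    (hA : ∀ w ∈ A, G.degree w = 3 → CliqueNode G w ∧ ∀ c, G.Adj w c → c ∈ A) :
    4 * (A.card : ℤ) ≤ cnt G A Finset.univ := by
  set Q := A.filter (fun w => G.degree w = 3) with hQ
  set R := A.filter (fun w => ¬ G.degree w = 3) with hR
  have hQd : ∀ w ∈ Q, G.degree w = 3 := fun w hw => (Finset.mem_filter.1 hw).2
  have hQA : ∀ w ∈ Q, w ∈ A := fun w hw => (Finset.mem_filter.1 hw).1
  have h1 : 2 * (Q.card : ℤ) ≤ cnt G Q R := by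
    rw [cnt_eq_sum]
    have : ∀ w ∈ Q, 2 ≤ cnt G {w} R := by
      intro w hw
      have hd := hQd w hw
      obtain ⟨hq, hin⟩ := hA w (hQA w hw) hd
      -- Two nodes among the neighbours of `w` would form a triangle of nodes with it, so at least
      -- two neighbours are non-nodes.
      obtain ⟨s, hs, hother⟩ : ∃ s, G.Adj w s ∧ ∀ r, G.Adj w r → r ≠ s → G.degree r ≠ 3 := by
        by_cases hex : ∃ s, G.Adj w s ∧ G.degree s = 3
        · obtain ⟨s, hs, hsd⟩ := hex
          exact ⟨s, hs, fun r hr hrs hrd => h.circ.no_triangle_of_nodes hd hsd hrd hs hr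
            (hq s r hs hr hrs.symm)⟩
        · push Not at hex
          obtain ⟨x, y, z, -, -, -, hN⟩ := exists_neighbors hd
          exact ⟨x, (hN x).2 (Or.inl rfl), fun r hr _ => hex r hr⟩
      have hsub : R.erase s ⊆ R := Finset.erase_subset _ _
      rw [← cnt_eq_two hd hs (Y := R.erase s) (by simp) fun r hr hrs =>
        Finset.mem_erase.2 ⟨hrs, Finset.mem_filter.2 ⟨hin r hr, hother r hr hrs⟩⟩]
      exact cnt_mono G subset_rfl hsub
    have := Finset.card_nsmul_le_sum Q _ 2 this
    simpa [mul_comm] using this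
  -- With `h1` this gives `|Q| ≤ ∑_R (deg a - 4)`: the excess over degree 4 in `R` pays for the
  -- deficit 1 of each node.
  have h2 : cnt G Q R ≤ ∑ a ∈ R, 2 * ((G.degree a : ℤ) - 4) := by
    rw [cnt_comm, cnt_eq_sum]
    exact Finset.sum_le_sum fun a ha => h.cnt_nodes_le
      (fun w hw => ⟨hQd w hw, (hA w (hQA w hw) (hQd w hw)).1⟩) (Finset.mem_filter.1 ha).2
  have h3 : (A.card : ℤ) = Q.card + R.card := by
    exact_mod_cast (Finset.card_filter_add_card_filter_not (s := A)
      (fun w => G.degree w = 3)).symm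
  have h4 : ∑ a ∈ A, (G.degree a : ℤ) = ∑ a ∈ Q, (G.degree a : ℤ) + ∑ a ∈ R, (G.degree a : ℤ) :=
    (Finset.sum_filter_add_sum_filter_not A _ _).symm
  have h5 : ∑ a ∈ Q, (G.degree a : ℤ) = ∑ a ∈ Q, 3 :=
    Finset.sum_congr rfl fun w hw => by rw [hQd w hw]; rfl
  rw [h5] at h4
  rw [← Finset.mul_sum, Finset.sum_sub_distrib] at h2
  rw [← sum_degree, h4]
  simp only [Finset.sum_const, nsmul_eq_mul] at h2 ⊢
  linarith

lemma exists_indepNode : ∃ v, G.degree v = 3 ∧ IndepNode G v := by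
  by_contra! hno
  have h1 := h.four_mul_card_le (A := Finset.univ) fun w _ hw =>
    ⟨(h.cliqueNode_or_indepNode hw).resolve_right (hno w hw), fun c _ => Finset.mem_univ c⟩
  have h2 := h.circ.total
  unfold slack at h2
  linarith

lemma indepNode_of_adj {w s : V} (hi : IndepNode G w) (hws : G.Adj w s) (hs : G.degree s = 3) :
    IndepNode G s :=
  (h.cliqueNode_or_indepNode hs).resolve_left fun hq => hq.not_indepNode hs hws.symm hi

/-- Otherwise the set of independent nodes is closed under adjacency, hence is `V`; but a cubic
circuit has `3|V| = 4|V| - 2`, so only two vertices. -/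
lemma exists_indepNode_adj :
    ∃ v z, G.degree v = 3 ∧ IndepNode G v ∧ G.Adj v z ∧ G.degree z ≠ 3 := by
  classical
  by_contra! hno
  obtain ⟨v, hv, hvi⟩ := h.exists_indepNode
  have hu := h.circ.eq_univ_of_nodes
    (Q := Finset.univ.filter fun w => G.degree w = 3 ∧ IndepNode G w)
    ⟨v, by simp [hv, hvi]⟩ (fun w hw => (Finset.mem_filter.1 hw).2.1) (by
      intro w hw
      obtain ⟨-, hd, hi⟩ := Finset.mem_filter.1 hw
      rw [cnt_eq_three hd]
      · norm_num
      · intro r hr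
        have hrd := hno w r hd hi hr
        simp [hrd, h.indepNode_of_adj hi hr hrd])
  have hd : ∀ w ∈ (Finset.univ : Finset V), G.degree w = 3 := by
    intro w hw
    rw [← hu] at hw
    exact (Finset.mem_filter.1 hw).2.1
  have h1 := sum_degree G Finset.univ
  rw [Finset.sum_congr rfl (fun w hw => by rw [hd w hw])] at h1
  have h2 := h.circ.total
  unfold slack at h2
  simp only [Finset.sum_const, nsmul_eq_mul, Nat.cast_ofNat] at h1
  have h3 := G.degree_lt_card_verts v
  rw [hv, ← Finset.card_univ] at h3
  omega

end Irreducible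

/-- A tight set witnessing that the neighbours of the node `v` other than `z` cannot be joined. -/
structure Obstruction (G : SimpleGraph V) [DecidableRel G.Adj] (v z : V) (X : Finset V) :
    Prop where
  degree : G.degree v = 3
  indep : IndepNode G v
  adj : G.Adj v z
  degree_ne : G.degree z ≠ 3
  tight : Tight G X
  notMem : v ∉ X
  notMem' : z ∉ X
  mem : ∀ r, G.Adj v r → r ≠ z → r ∈ X

namespace Obstruction

variable {v z : V} {X : Finset V} (o : Obstruction G v z X)
include o

lemma notMem_insert : z ∉ insert v X := by
  simp [o.adj.ne', o.notMem']

lemma tight_insert (h : Circ G) : Tight G (insert v X) :=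
  h.tight_insert o.tight o.notMem (cnt_eq_two o.degree o.adj o.notMem' o.mem).ge
    (ne_univ_of_notMem o.notMem_insert)

/-- `P - v` is again an obstruction for `v`, `z`. So `X + v` is maximal among the tight sets
avoiding `z`. -/
lemma eq_of_subset (hmax : ∀ v' z' X', Obstruction G v' z' X' → X'.card ≤ X.card)
    {P : Finset V} (hP : Tight G P) (hsub : insert v X ⊆ P) (hz : z ∉ P) : insert v X = P := by
  have hv : v ∈ P := hsub (by simp)
  have ht := Circ.tight_erase hP hv
    (cnt_eq_two o.degree o.adj hz fun r hr hrz => hsub (by simp [o.mem r hr hrz]))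
  have hc := hmax v z (P.erase v) ⟨o.degree, o.indep, o.adj, o.degree_ne, ht, by simp,
    by simp [hz], fun r hr hrz => by
      rw [Finset.mem_erase]
      exact ⟨hr.ne', hsub (by simp [o.mem r hr hrz])⟩⟩
  refine Finset.eq_of_subset_of_card_le hsub ?_
  rw [Finset.card_insert_of_notMem o.notMem]
  rw [Finset.card_erase_of_mem hv] at hc
  omega

/-- Let `P = X + v` and let `K` be the `K₄` around `w`. If `K` meets `P` in two vertices, they cover
`V` and `vz` is a forbidden edge between the differences. If it meets `P` in one, the union has
slack `4 - 2d`. For `z ∈ K` the edge `vz` forces `d = 1` and union `V`, while `deg z ≥ 5` gives two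
edges from `z` to `P \ K`; for `z ∉ K` the union is tight, against maximality. -/
lemma clique_inside (h : Irreducible G)
    (hmax : ∀ v' z' X', Obstruction G v' z' X' → X'.card ≤ X.card) {w : V}
    (hwP : w ∉ insert v X) (hw : G.degree w = 3) (hq : CliqueNode G w) {c : V}
    (hwc : G.Adj w c) : c ∉ insert v X := by
  intro hcP
  have hP := o.tight_insert h.circ
  have hzP := o.notMem_insert
  have hK := hq.adj_nbhd
  have hvP : v ∈ insert v X := by simp
  set P := insert v X with hPdef
  have hwK : w ∈ nbhd G w := by simp [mem_nbhd]
  have hcK : c ∈ nbhd G w := by simp [mem_nbhd, hwc]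
  have hvK : v ∉ nbhd G w := by
    rw [mem_nbhd, not_or]
    refine ⟨fun he => hwP (by simp [← he, P]), fun ha => ?_⟩
    exact hq.not_indepNode hw ha o.indep
  by_cases hex : ∃ c', c' ∈ P ∧ c' ∈ nbhd G w ∧ c ≠ c'
  · obtain ⟨c', hc'P, hc'K, hcc'⟩ := hex
    obtain ⟨hu, h0⟩ :=
      h.circ.tight_meets_clique hK (card_nbhd hw) hP hcP hcK hc'P hc'K hcc' hwP hwK
    have hzK : z ∈ nbhd G w := by
      have : z ∈ P ∪ nbhd G w := by rw [hu]; simp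
      exact (Finset.mem_union.1 this).resolve_left hzP
    have := cnt_pos G (X := P \ nbhd G w) (Y := nbhd G w \ P) (a := v) (b := z)
      (Finset.mem_sdiff.2 ⟨hvP, hvK⟩) (Finset.mem_sdiff.2 ⟨hzK, hzP⟩) o.adj
    omega
  · push Not at hex
    have hcap : P ∩ nbhd G w = {c} := by
      ext d
      rw [Finset.mem_inter, Finset.mem_singleton]
      refine ⟨fun hd => (hex d hd.1 hd.2).symm, ?_⟩
      rintro rfl
      exact ⟨hcP, hcK⟩
    have hs := slack_union_add_inter G P (nbhd G w)
    rw [hcap, slack_singleton, hP.2, (h.circ.tight_of_clique hK (card_nbhd hw)).2] at hs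
    have hne : (P ∪ nbhd G w).Nonempty := ⟨v, by simp [hvP]⟩
    have h0 := cnt_nonneg G (P \ nbhd G w) (nbhd G w \ P)
    by_cases hzK : z ∈ nbhd G w
    · have h1 := cnt_pos G (X := P \ nbhd G w) (Y := nbhd G w \ P) (a := v) (b := z)
        (Finset.mem_sdiff.2 ⟨hvP, hvK⟩) (Finset.mem_sdiff.2 ⟨hzK, hzP⟩) o.adj
      have h2 := h.circ.two_le_slack hne
      have hu := h.circ.eq_univ hne (by omega)
      have hwz : G.Adj w z := by
        rw [mem_nbhd] at hzK
        exact hzK.resolve_left fun he => o.degree_ne (he ▸ hw)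
      have h5 := h.five_le_degree hw hq hwz o.degree_ne
      have h6 : (G.degree z : ℤ) = cnt G {z} (nbhd G w) + cnt G {z} (P \ nbhd G w) := by
        rw [← cnt_univ, ← cnt_union_right G Finset.disjoint_sdiff, Finset.union_sdiff_self_eq_union,
          Finset.union_comm, hu]
      have h7 : cnt G {z} (nbhd G w) ≤ 3 := by
        have hsub : (nbhd G w).filter (G.Adj z) ⊆ (nbhd G w).erase z := by
          intro d hd
          rw [Finset.mem_filter] at hd
          exact Finset.mem_erase.2 ⟨hd.2.ne', hd.1⟩
        have := Finset.card_le_card hsub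
        rw [Finset.card_erase_of_mem hzK, card_nbhd hw] at this
        rw [cnt_singleton]
        exact_mod_cast this
      have h8 : cnt G {z} (P \ nbhd G w) ≤ cnt G (P \ nbhd G w) (nbhd G w \ P) := by
        rw [cnt_comm]
        exact cnt_mono G subset_rfl
          (Finset.singleton_subset_iff.2 (Finset.mem_sdiff.2 ⟨hzK, hzP⟩))
      omega
    · have hz : z ∉ P ∪ nbhd G w := by simp [hzP, hzK]
      have h1 := h.circ.sparse _ hne (ne_univ_of_notMem hz)
      have ht : Tight G (P ∪ nbhd G w) := ⟨ne_univ_of_notMem hz, by omega⟩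
      have := o.eq_of_subset hmax ht Finset.subset_union_left hz
      exact hwP (by rw [← hPdef] at this; rw [this]; simp [hwK])

/-- The independent nodes outside `P = X + v` induce a forest; let `w` have degree at most one in
it. Among its neighbours there is at most one node outside `P`, one vertex of `P` and one non-node
outside `P`, hence exactly one of each. The tight set `Y` obtained by omitting the non-node `s` then
enlarges `P` to a tight set still avoiding `z`. -/
lemma no_indepNode_outside (h : Irreducible G)
    (hmax : ∀ v' z' X', Obstruction G v' z' X' → X'.card ≤ X.card) {w₀ : V}
    (hw₀P : w₀ ∉ insert v X) (hw₀ : G.degree w₀ = 3) (hi₀ : IndepNode G w₀) : False := by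
  classical
  have hP := o.tight_insert h.circ
  have hzP := o.notMem_insert
  have hvP : v ∈ insert v X := by simp
  have hcard : (insert v X).card = X.card + 1 := Finset.card_insert_of_notMem o.notMem
  have hmaxP : ∀ P', Tight G P' → insert v X ⊆ P' → z ∉ P' → insert v X = P' :=
    fun P' => o.eq_of_subset hmax
  set P := insert v X with hPdef
  set Q := Finset.univ.filter fun w => w ∉ P ∧ G.degree w = 3 ∧ IndepNode G w with hQ
  have hmemQ : ∀ w, w ∈ Q ↔ w ∉ P ∧ G.degree w = 3 ∧ IndepNode G w := by simp [hQ]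
  obtain ⟨w, hwQ, hleaf⟩ : ∃ w ∈ Q, cnt G {w} Q ≤ 1 := by
    by_contra! hall
    have hu := h.circ.eq_univ_of_nodes (Q := Q) ⟨w₀, (hmemQ w₀).2 ⟨hw₀P, hw₀, hi₀⟩⟩
      (fun w hw => ((hmemQ w).1 hw).2.1) (fun w hw => hall w hw)
    exact ((hmemQ v).1 (by rw [hu]; simp)).1 hvP
  obtain ⟨hwP, hw, hi⟩ := (hmemQ w).1 hwQ
  have hwv : v ≠ w := fun he => hwP (he ▸ hvP)
  have hnode : ∀ r r', G.Adj w r → G.Adj w r' → r ∉ P → r' ∉ P → G.degree r = 3 →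
      G.degree r' = 3 → r = r' := by
    intro r r' hr hr' hrP hrP' hd hd'
    rw [cnt_singleton] at hleaf
    have hle : (Q.filter (G.Adj w)).card ≤ 1 := by exact_mod_cast hleaf
    refine Finset.card_le_one.1 hle r ?_ r' ?_
    · exact Finset.mem_filter.2 ⟨(hmemQ r).2 ⟨hrP, hd, h.indepNode_of_adj hi hr hd⟩, hr⟩
    · exact Finset.mem_filter.2 ⟨(hmemQ r').2 ⟨hrP', hd', h.indepNode_of_adj hi hr' hd'⟩, hr'⟩
  -- Two neighbours in `P` would make `P + w` tight, against maximality.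
  have hinP : ∀ r r', G.Adj w r → G.Adj w r' → r ∈ P → r' ∈ P → r = r' := by
    intro r r' hr hr' hrP hrP'
    by_contra hne
    have hzw : z ∉ insert w P := by
      rw [Finset.mem_insert, not_or]
      exact ⟨fun he => o.degree_ne (he ▸ hw), hzP⟩
    have h2 : 2 ≤ cnt G {w} P := by
      rw [cnt_singleton]
      exact_mod_cast Finset.one_lt_card.2
        ⟨r, by simp [hrP, hr], r', by simp [hrP', hr'], hne⟩
    have := hmaxP _ (h.circ.tight_insert hP hwP h2 (ne_univ_of_notMem hzw))
      (Finset.subset_insert _ _) hzw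
    exact hwP (by rw [this]; simp)
  -- If `v ∈ Y`, then `Y ∪ P` is an obstruction for `w`, `s` larger than `X`.
  have hv : ∀ s, G.Adj w s → s ∉ P → G.degree s ≠ 3 → ∀ Y, Tight G Y → w ∉ Y → s ∉ Y →
      (∀ r, G.Adj w r → r ≠ s → r ∈ Y) → v ∉ Y := by
    intro s hs hsP hsd Y hY hwY hsY hm hvY
    have ht := (h.circ.tight_union hY hP hvY hvP hwY hwP).1
    have h1 := hmax w s (Y ∪ P) ⟨hw, hi, hs, hsd, ht, by simp [hwY, hwP], by simp [hsY, hsP],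
      fun r hr hrs => by simp [hm r hr hrs]⟩
    have h2 := Finset.card_le_card (Finset.subset_union_right (s₁ := Y) (s₂ := P))
    omega
  -- The tight sets for `s` and `s'` share the third neighbour of `w`. Their union is tight and
  -- contains all neighbours of `w`, so it is `V - w` and contains `v`, contrary to `hv`.
  have hnon : ∀ s s', G.Adj w s → G.Adj w s' → s ∉ P → s' ∉ P → G.degree s ≠ 3 →
      G.degree s' ≠ 3 → s = s' := by
    intro s s' hs hs' hsP hsP' hsd hsd'
    by_contra hne
    obtain ⟨Y, hY, hwY, hsY, hm⟩ := h.exists_tight_of_indepNode hw hi hs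
    obtain ⟨Y', hY', hwY', hsY', hm'⟩ := h.exists_tight_of_indepNode hw hi hs'
    obtain ⟨t, ht, hts, hts'⟩ : ∃ t, G.Adj w t ∧ t ≠ s ∧ t ≠ s' := by
      obtain ⟨x, y, hsx, hsy, hxy, hN⟩ := exists_other_neighbors hw hs
      by_cases hx : x = s'
      · exact ⟨y, by simp [hN], hsy.symm, fun hy => hxy (hx.trans hy.symm)⟩
      · exact ⟨x, by simp [hN], hsx.symm, hx⟩
    have hU := (h.circ.tight_union hY hY' (hm t ht hts) (hm' t ht hts') hwY hwY').1
    have hu := h.circ.insert_eq_univ hU (a := w) (by simp [hwY, hwY']) (cnt_eq_three hw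
      fun r hr => by
        by_cases hrs : r = s
        · subst hrs
          simp [hm' r hr hne]
        · simp [hm r hr hrs]).ge
    have : v ∈ insert w (Y ∪ Y') := by rw [hu]; simp
    rw [Finset.mem_insert, Finset.mem_union] at this
    rcases this with he | he | he
    · exact hwv he
    · exact hv s hs hsP hsd Y hY hwY hsY hm he
    · exact hv s' hs' hsP' hsd' Y' hY' hwY' hsY' hm' he
  obtain ⟨s, r, t, hs, hr, ht, hsP, hsd, hrP, htP, hrs, hts⟩ : ∃ s r t, G.Adj w s ∧ G.Adj w r ∧
      G.Adj w t ∧ s ∉ P ∧ G.degree s ≠ 3 ∧ r ∉ P ∧ t ∈ P ∧ r ≠ s ∧ t ≠ s := by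
    obtain ⟨x, y, t, hxy, hxt, hyt, hN⟩ := exists_neighbors hw
    have hx : G.Adj w x := by simp [hN]
    have hy : G.Adj w y := by simp [hN]
    have ht : G.Adj w t := by simp [hN]
    have k1 := hnode x y hx hy
    have k2 := hnode x t hx ht
    have k3 := hnode y t hy ht
    have k4 := hnon x y hx hy
    have k5 := hnon x t hx ht
    have k6 := hnon y t hy ht
    have k7 := hinP x y hx hy
    have k8 := hinP x t hx ht
    have k9 := hinP y t hy ht
    clear hnode hnon hinP hv hmaxP hmax hmemQ hN
    by_cases px : x ∈ P <;> by_cases py : y ∈ P <;> by_cases pt : t ∈ P <;>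
      by_cases dx : G.degree x = 3 <;> by_cases dy : G.degree y = 3 <;>
      by_cases dt : G.degree t = 3 <;> first
        | exact absurd (k1 px py dx dy) hxy
        | exact absurd (k2 px pt dx dt) hxt
        | exact absurd (k3 py pt dy dt) hyt
        | exact absurd (k4 px py dx dy) hxy
        | exact absurd (k5 px pt dx dt) hxt
        | exact absurd (k6 py pt dy dt) hyt
        | exact absurd (k7 px py) hxy
        | exact absurd (k8 px pt) hxt
        | exact absurd (k9 py pt) hyt
        | exact ⟨x, y, t, hx, hy, ht, px, dx, py, pt, hxy.symm, hxt.symm⟩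
        | exact ⟨y, x, t, hy, hx, ht, py, dy, px, pt, hxy, hyt.symm⟩
        | exact ⟨x, t, y, hx, ht, hy, px, dx, pt, py, hxt.symm, hxy.symm⟩
        | exact ⟨t, x, y, ht, hx, hy, pt, dt, px, py, hxt, hyt⟩
        | exact ⟨y, t, x, hy, ht, hx, py, dy, pt, px, hyt.symm, hxy⟩
        | exact ⟨t, y, x, ht, hy, hx, pt, dt, py, px, hyt, hxt⟩
  obtain ⟨Y, hY, hwY, hsY, hm⟩ := h.exists_tight_of_indepNode hw hi hs
  have hvY := hv s hs hsP hsd Y hY hwY hsY hm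
  obtain ⟨hU, h0⟩ := h.circ.tight_union hY hP (hm t ht hts) htP hwY hwP
  have hzY : z ∉ Y := by
    intro hzY
    have := cnt_pos G (X := Y \ P) (Y := P \ Y) (a := z) (b := v)
      (Finset.mem_sdiff.2 ⟨hzY, hzP⟩) (Finset.mem_sdiff.2 ⟨hvP, hvY⟩) o.adj.symm
    omega
  have := hmaxP _ hU Finset.subset_union_right (by simp [hzY, hzP])
  exact hrP (by rw [this]; simp [hm r hr hrs])

end Obstruction

lemma Irreducible.false (h : Irreducible G) : False := by
  classical
  obtain ⟨v, z, X, o, hmax⟩ : ∃ v z X, Obstruction G v z X ∧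
      ∀ v' z' X', Obstruction G v' z' X' → X'.card ≤ X.card := by
    obtain ⟨v, z, hv, hi, hvz, hz⟩ := h.exists_indepNode_adj
    obtain ⟨X, hX, hvX, hzX, hm⟩ := h.exists_tight_of_indepNode hv hi hvz
    obtain ⟨Y, hY, hYmax⟩ := Finset.exists_max_image
      (Finset.univ.filter fun Y => ∃ v z, Obstruction G v z Y) Finset.card
      ⟨X, by simpa using ⟨v, z, hv, hi, hvz, hz, hX, hvX, hzX, hm⟩⟩
    obtain ⟨-, v', z', o⟩ := Finset.mem_filter.1 hY
    exact ⟨v', z', Y, o, fun a b Z oZ => hYmax Z (by simpa using ⟨a, b, oZ⟩)⟩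
  have hP := o.tight_insert h.circ
  have hzP := o.notMem_insert
  have h1 := h.four_mul_card_le (A := (insert v X)ᶜ) (by
    intro w hwA hw
    have hwP : w ∉ insert v X := Finset.mem_compl.1 hwA
    have hq : CliqueNode G w := (h.cliqueNode_or_indepNode hw).resolve_right
      fun hi => o.no_indepNode_outside h hmax hwP hw hi
    exact ⟨hq, fun c hc => Finset.mem_compl.2 (o.clique_inside h hmax hwP hw hq hc)⟩)
  have h2 := h.circ.sparse (insert v X)ᶜ ⟨z, Finset.mem_compl.2 hzP⟩
    (ne_univ_of_notMem (a := v) (by simp))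
  have h3 := h.circ.total
  have h4 := hP.2
  have h5 := cnt_univ_univ G (insert v X)
  have h6 := cnt_univ_right G (insert v X)ᶜ (insert v X)
  have h7 := cnt_comm G (insert v X) (insert v X)ᶜ
  have h8 : (((insert v X).card : ℤ)) + (insert v X)ᶜ.card = (Finset.univ : Finset V).card := by
    exact_mod_cast Finset.card_add_card_compl (insert v X)
  -- The degree bound `h1` says `cnt P Pᶜ ≥ slack Pᶜ` for `P = X + v`. Since `2 = slack P + slack Pᶜ
  -- - 2 cnt P Pᶜ` and `slack P = 4`, this gives `slack Pᶜ ≤ 2`, against `h2`.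
  unfold slack at h2 h3 h4
  linarith

end Main

/-! ### Inverse moves and when they preserve circuits -/

section Reductions

variable {V : Type u}

/-- Contract the edge `uv` to `v` and omit the edge `ux`. -/
def contractEdge (G : SimpleGraph V) (u v x : V) : SimpleGraph {c : V // c ≠ u} where
  Adj c d := G.Adj c.1 d.1 ∨ (c.1 = v ∧ G.Adj u d.1 ∧ d.1 ≠ x ∧ d.1 ≠ v) ∨
    (d.1 = v ∧ G.Adj u c.1 ∧ c.1 ≠ x ∧ c.1 ≠ v)
  symm := ⟨fun c d hcd => by rw [G.adj_comm d.1]; tauto⟩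
  loopless := ⟨fun c hc => by
    rcases hc with hc | ⟨h1, -, -, h2⟩ | ⟨h1, -, -, h2⟩
    exacts [G.irrefl hc, h2 h1, h2 h1]⟩

/-- Delete `u₁` and `u₂` and join `v₁` to `v₂`. -/
def deletePairAddEdge (G : SimpleGraph V) (u₁ u₂ v₁ v₂ : V) (hv : v₁ ≠ v₂) :
    SimpleGraph {c : V // c ≠ u₁ ∧ c ≠ u₂} where
  Adj c d := G.Adj c.1 d.1 ∨ (c.1 = v₁ ∧ d.1 = v₂) ∨ (d.1 = v₁ ∧ c.1 = v₂)
  symm := ⟨fun c d hcd => by rw [G.adj_comm d.1]; tauto⟩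
  loopless := ⟨fun c hc => by
    rcases hc with hc | ⟨h1, h2⟩ | ⟨h1, h2⟩
    exacts [G.irrefl hc, hv (h1.symm.trans h2), hv (h1.symm.trans h2)]⟩

/-- Split the contracted vertex so that `u` is the new vertex `Sum.inr 0` with `N₁ = N(u) \ {v, x}`
and `v` is `Sum.inr 1` with `N₂ = N(v) \ {u}`. These are disjoint because only `x` can be a common
neighbour. -/
lemma isGeneralisedVertexSplit_contractEdge {G : SimpleGraph V} {u v x : V} (huv : G.Adj u v)
    (hux : G.Adj u x) (hxv : x ≠ v) (hcommon : ∀ c, G.Adj u c → G.Adj v c → c = x)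
    (hu : ∃ c, G.Adj u c ∧ c ≠ v ∧ c ≠ x) (hv : ∃ c, G.Adj v c ∧ c ≠ u) :
    IsGeneralisedVertexSplit (contractEdge G u v x) G := by
  refine ⟨⟨v, huv.ne'⟩, {c | G.Adj u c.1 ∧ c.1 ≠ v ∧ c.1 ≠ x}, {c | G.Adj v c.1},
    ⟨x, hux.ne'⟩, ?_, ?_, ?_, ?_, ?_, ?_, ?_⟩
  · obtain ⟨c, hc⟩ := hu
    exact ⟨⟨c, hc.1.ne'⟩, hc⟩
  · obtain ⟨c, hc, hcu⟩ := hv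
    exact ⟨⟨c, hcu⟩, hc⟩
  · rw [Set.disjoint_left]
    rintro c ⟨h1, h2, h3⟩ h4
    exact h3 (hcommon c.1 h1 h4)
  · ext c
    simp only [Set.mem_union, Set.mem_ofPred_eq, SimpleGraph.mem_neighborSet, contractEdge]
    constructor
    · rintro (⟨h1, h2, h3⟩ | h4)
      · exact Or.inr (Or.inl ⟨trivial, h1, h3, h2⟩)
      · exact Or.inl h4
    · rintro (h1 | ⟨-, h1, h2, h3⟩ | ⟨-, -, -, h⟩)
      · exact Or.inr h1
      · exact Or.inl ⟨h1, h3, h2⟩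
      · exact absurd rfl h
  · exact fun he => hxv (congrArg Subtype.val he)
  · exact fun hm => hm.2.2 rfl
  · set g : {c : {c : V // c ≠ u} // c ≠ ⟨v, huv.ne'⟩} ⊕ Fin 2 → V :=
      Sum.elim (fun c => c.1.1) ![u, v] with hg
    have hcv : ∀ c : {c : {c : V // c ≠ u} // c ≠ ⟨v, huv.ne'⟩}, c.1.1 ≠ v :=
      fun c he => c.2 (Subtype.ext he)
    have hb : Function.Bijective g := by
      constructor
      · rintro (c | i) (d | j) hcd
        · exact congrArg Sum.inl (Subtype.ext (Subtype.ext hcd))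
        · fin_cases j
          · exact absurd hcd c.1.2
          · exact absurd hcd (hcv c)
        · fin_cases i
          · exact absurd hcd.symm d.1.2
          · exact absurd hcd.symm (hcv d)
        · fin_cases i <;> fin_cases j
          · rfl
          · exact absurd hcd huv.ne
          · exact absurd hcd huv.ne'
          · rfl
      · intro c
        by_cases hcu : c = u
        · exact ⟨Sum.inr 0, hcu.symm⟩
        · by_cases hcv' : c = v
          · exact ⟨Sum.inr 1, hcv'.symm⟩
          · exact ⟨Sum.inl ⟨⟨c, hcu⟩, fun he => hcv' (congrArg Subtype.val he)⟩, rfl⟩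
    refine ⟨(⟨Equiv.ofBijective g hb, ?_⟩ : vertexSplit _ _ _ _ _ ≃g G).symm⟩
    have key0 : ∀ c : {c : {c : V // c ≠ u} // c ≠ ⟨v, huv.ne'⟩},
        (c.1 ∈ {c : {c : V // c ≠ u} | G.Adj u c.1 ∧ c.1 ≠ v ∧ c.1 ≠ x} ∨
          c.1 = ⟨x, hux.ne'⟩) ↔ G.Adj u c.1.1 := by
      intro c
      constructor
      · rintro (hc | hc)
        · exact hc.1
        · rw [hc]
          exact hux
      · intro hc
        by_cases hcx : c.1.1 = x
        · exact Or.inr (Subtype.ext hcx)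
        · exact Or.inl ⟨hc, hcv c, hcx⟩
    rintro (c | i) (d | j)
    · have hne : (Sum.inl c : {c : {c : V // c ≠ u} // c ≠ ⟨v, huv.ne'⟩} ⊕ Fin 2) ≠ Sum.inl d ↔
          c.1.1 ≠ d.1.1 := by
        rw [Ne, Sum.inl.injEq, Subtype.ext_iff, Subtype.ext_iff]
      simp only [vertexSplit, SimpleGraph.fromRel_adj, contractEdge, hcv c, hcv d, hne]
      simp only [false_and, or_false, Equiv.ofBijective_apply, hg, Sum.elim_inl]
      rw [G.adj_comm d.1.1, or_self]
      exact ⟨fun hcd => ⟨hcd.ne, hcd⟩, fun hcd => hcd.2⟩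
    · simp only [vertexSplit, SimpleGraph.fromRel_adj, key0]
      fin_cases j
      · simp [hg, G.adj_comm u]
      · simp [hg, G.adj_comm v]
    · simp only [vertexSplit, SimpleGraph.fromRel_adj, key0]
      fin_cases i
      · simp [hg]
      · simp [hg]
    · simp only [vertexSplit, SimpleGraph.fromRel_adj]
      fin_cases i <;> fin_cases j <;> simp [hg, huv, huv.symm]

lemma isK4MinusExtension_deletePairAddEdge {G : SimpleGraph V} {u₁ u₂ v₁ v₂ : V} (hv : v₁ ≠ v₂)
    (h₁ : ∀ c, G.Adj u₁ c ↔ c = u₂ ∨ c = v₁ ∨ c = v₂)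
    (h₂ : ∀ c, G.Adj u₂ c ↔ c = u₁ ∨ c = v₁ ∨ c = v₂) (hadj : ¬ G.Adj v₁ v₂) :
    IsK4MinusExtension (deletePairAddEdge G u₁ u₂ v₁ v₂ hv) G := by
  have a12 : G.Adj u₁ u₂ := by simp [h₁]
  have a11 : G.Adj u₁ v₁ := by simp [h₁]
  have a1 : G.Adj u₁ v₂ := by simp [h₁]
  have a21 : G.Adj u₂ v₁ := by simp [h₂]
  have a22 : G.Adj u₂ v₂ := by simp [h₂]
  refine ⟨⟨v₁, a11.ne', a21.ne'⟩, ⟨v₂, a1.ne', a22.ne'⟩, Or.inr (Or.inl ⟨rfl, rfl⟩), ?_⟩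
  set g : {c : V // c ≠ u₁ ∧ c ≠ u₂} ⊕ Fin 2 → V := Sum.elim (fun c => c.1) ![u₁, u₂] with hg
  have hb : Function.Bijective g := by
    constructor
    · rintro (c | i) (d | j) hcd
      · exact congrArg Sum.inl (Subtype.ext hcd)
      · fin_cases j
        · exact absurd hcd c.2.1
        · exact absurd hcd c.2.2
      · fin_cases i
        · exact absurd hcd.symm d.2.1
        · exact absurd hcd.symm d.2.2
      · fin_cases i <;> fin_cases j
        · rfl
        · exact absurd hcd a12.ne
        · exact absurd hcd a12.ne'
        · rfl
    · intro c
      by_cases hc1 : c = u₁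
      · exact ⟨Sum.inr 0, hc1.symm⟩
      · by_cases hc2 : c = u₂
        · exact ⟨Sum.inr 1, hc2.symm⟩
        · exact ⟨Sum.inl ⟨c, hc1, hc2⟩, rfl⟩
  refine ⟨(⟨Equiv.ofBijective g hb, ?_⟩ : k4MinusExtend _ _ _ ≃g G).symm⟩
  have key : ∀ c : {c : V // c ≠ u₁ ∧ c ≠ u₂},
      (c = ⟨v₁, a11.ne', a21.ne'⟩ ∨ c = ⟨v₂, a1.ne', a22.ne'⟩) ↔ (c.1 = v₁ ∨ c.1 = v₂) := by
    intro c
    rw [Subtype.ext_iff, Subtype.ext_iff]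
  rintro (c | i) (d | j)
  · have hne : (Sum.inl c : {c : V // c ≠ u₁ ∧ c ≠ u₂} ⊕ Fin 2) ≠ Sum.inl d ↔ c.1 ≠ d.1 := by
      rw [Ne, Sum.inl.injEq, Subtype.ext_iff]
    simp only [k4MinusExtend, SimpleGraph.fromRel_adj, deletePairAddEdge, hne, Sym2.eq_iff, Ne,
      Equiv.ofBijective_apply, hg, Sum.elim_inl, Subtype.ext_iff]
    constructor
    · intro hcd
      refine ⟨hcd.ne, Or.inl ⟨Or.inl hcd, ?_⟩⟩
      rintro (⟨e1, e2⟩ | ⟨e1, e2⟩)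
      · exact hadj (by rw [← e1, ← e2]; exact hcd)
      · exact hadj (by rw [← e1, ← e2]; exact hcd.symm)
    · rintro ⟨-, ⟨hcd, hn⟩ | ⟨hcd, hn⟩⟩
      · rcases hcd with hcd | ⟨e1, e2⟩ | ⟨e1, e2⟩
        · exact hcd
        · exact (hn (Or.inl ⟨e1, e2⟩)).elim
        · exact (hn (Or.inr ⟨e2, e1⟩)).elim
      · rcases hcd with hcd | ⟨e1, e2⟩ | ⟨e1, e2⟩
        · exact hcd.symm
        · exact (hn (Or.inl ⟨e1, e2⟩)).elim
        · exact (hn (Or.inr ⟨e2, e1⟩)).elim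
  · simp only [k4MinusExtend, SimpleGraph.fromRel_adj, key]
    fin_cases j
    · simp [hg, G.adj_comm _ u₁, h₁, c.2.2]
    · simp [hg, G.adj_comm _ u₂, h₂, c.2.1]
  · simp only [k4MinusExtend, SimpleGraph.fromRel_adj, key]
    fin_cases i
    · simp [hg, h₁, d.2.2]
    · simp [hg, h₂, d.2.1]
  · simp only [k4MinusExtend, SimpleGraph.fromRel_adj]
    fin_cases i <;> fin_cases j <;> simp [hg, a12, a12.symm]

variable [Fintype V] [DecidableEq V] {G : SimpleGraph V} [DecidableRel G.Adj]

/-- Parity turns "proper and not tight" into slack at least 6, as needed after a contraction that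
loses 2. -/
lemma even_slack (G : SimpleGraph V) [DecidableRel G.Adj] (X : Finset V) : Even (slack G X) := by
  unfold slack
  rw [← two_mul_ncard_inside, Int.even_iff]
  omega

/-- The effect on `cnt` of passing to a subtype and joining `v` to the vertices in `S`. -/
lemma cnt_subtype_join {p : V → Prop} [DecidableEq {c // p c}] {H : SimpleGraph {c // p c}}
    [DecidableRel H.Adj] {v : V} {S : V → Prop} [DecidablePred S]
    (hH : ∀ a b, H.Adj a b ↔ G.Adj a.1 b.1 ∨ (a.1 = v ∧ S b.1) ∨ (b.1 = v ∧ S a.1))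
    (hS : ∀ b, S b → b ≠ v ∧ ¬ G.Adj v b) (Y : Finset {c // p c}) :
    cnt H Y Y = cnt G (Y.map (.subtype p)) (Y.map (.subtype p)) +
      if v ∈ Y.map (.subtype p) then
        2 * ∑ b ∈ Y.map (.subtype p), (if S b then 1 else 0) else 0 := by
  have hf : ∀ a b : {c // p c}, (if H.Adj a b then 1 else 0 : ℤ) =
      (if G.Adj a.1 b.1 then 1 else 0) + (if a.1 = v then (if S b.1 then 1 else 0) else 0) +
        (if b.1 = v then (if S a.1 then 1 else 0) else 0) := by
    intro a b
    rw [← ite_and, ← ite_and]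
    by_cases h1 : G.Adj a.1 b.1
    · rw [if_pos ((hH a b).2 (Or.inl h1)), if_pos h1, if_neg, if_neg]
      · rfl
      · rintro ⟨e, h2⟩
        exact (hS _ h2).2 (e ▸ h1.symm)
      · rintro ⟨e, h2⟩
        exact (hS _ h2).2 (e ▸ h1)
    · rw [if_neg h1]
      by_cases e1 : a.1 = v ∧ S b.1
      · rw [if_pos ((hH a b).2 (Or.inr (Or.inl e1))), if_pos e1,
          if_neg fun e2 => (hS _ e1.2).1 e2.1]
        rfl
      · by_cases e2 : b.1 = v ∧ S a.1
        · rw [if_pos ((hH a b).2 (Or.inr (Or.inr e2))), if_neg e1, if_pos e2]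
          rfl
        · rw [if_neg (by rw [hH]; tauto), if_neg e1, if_neg e2]
          rfl
  have hsum : cnt H Y Y = ∑ a ∈ Y.map (.subtype p), ∑ b ∈ Y.map (.subtype p),
      ((if G.Adj a b then 1 else 0) + (if a = v then (if S b then 1 else 0) else 0) +
        (if b = v then (if S a then 1 else 0) else 0)) := by
    simp only [cnt, hf, Finset.sum_map]
    rfl
  rw [hsum]
  set X := Y.map (.subtype p)
  have h1 : ∑ a ∈ X, ∑ b ∈ X, (if a = v then (if S b then 1 else 0) else 0 : ℤ) =
      if v ∈ X then ∑ b ∈ X, (if S b then 1 else 0) else 0 := by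
    rw [Finset.sum_comm]
    simp only [Finset.sum_ite_eq']
    split_ifs <;> simp
  have h2 : ∑ a ∈ X, ∑ b ∈ X, (if b = v then (if S a then 1 else 0) else 0 : ℤ) =
      if v ∈ X then ∑ b ∈ X, (if S b then 1 else 0) else 0 := by
    rw [← h1, Finset.sum_comm]
  simp only [Finset.sum_add_distrib]
  rw [h1, h2]
  unfold cnt
  split_ifs <;> ring

lemma Circ.isCircuit_contractEdge (h : Circ G) {u v x : V} (huv : G.Adj u v) (hux : G.Adj u x)
    (hxv : x ≠ v) (hcommon : ∀ c, G.Adj u c → G.Adj v c → c = x)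
    (hZ : ∀ Z, Tight G Z → u ∈ Z → v ∈ Z → x ∈ Z) : IsCircuit (contractEdge G u v x) := by
  classical
  have hcnt : ∀ Y : Finset {c : V // c ≠ u}, cnt (contractEdge G u v x) Y Y =
      cnt G (Y.map (.subtype _)) (Y.map (.subtype _)) + if v ∈ Y.map (.subtype _) then
        2 * ∑ b ∈ Y.map (.subtype _), (if G.Adj u b ∧ b ≠ x ∧ b ≠ v then 1 else 0) else 0 := by
    refine cnt_subtype_join (fun a b => ?_) ?_
    · simp only [contractEdge]
    · rintro b ⟨h1, h2, h3⟩
      exact ⟨h3, fun hvb => h2 (hcommon b h1 hvb)⟩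
  -- Losing the vertex `u` costs 4; losing `uv`, and `ux` if `x` is present, gives back 2 each. All
  -- other edges at `u` move to `v`.
  have hslack : ∀ Y : Finset {c : V // c ≠ u}, v ∈ Y.map (.subtype _) →
      slack (contractEdge G u v x) Y = slack G (insert u (Y.map (.subtype _))) - 2 +
        if x ∈ Y.map (.subtype _) then 2 else 0 := by
    intro Y hvY
    have huY : u ∉ Y.map (.subtype (fun c => c ≠ u)) := by simp
    have hcY : ((Y.map (.subtype (fun c => c ≠ u))).card : ℤ) = Y.card := by
      rw [Finset.card_map]
    rw [slack_insert G huY]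
    unfold slack
    rw [hcnt, if_pos hvY, hcY]
    set X := Y.map (.subtype (fun c => c ≠ u)) with hX
    have : cnt G {u} X = ∑ b ∈ X, (if G.Adj u b ∧ b ≠ x ∧ b ≠ v then 1 else 0) +
        ∑ b ∈ X, (if b = v then 1 else 0) + ∑ b ∈ X, (if b = x then 1 else 0) := by
      rw [← Finset.sum_add_distrib, ← Finset.sum_add_distrib]
      simp only [cnt, Finset.sum_singleton]
      refine Finset.sum_congr rfl fun b _ => ?_
      by_cases hbv : b = v
      · subst hbv
        simp [huv, hxv.symm]
      · by_cases hbx : b = x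
        · subst hbx
          simp [hux, hbv]
        · simp [hbv, hbx]
    rw [this]
    simp only [Finset.sum_ite_eq', hvY, if_true]
    split_ifs <;> ring
  have huniv : insert u ((Finset.univ : Finset {c : V // c ≠ u}).map (.subtype _)) =
      Finset.univ := by
    ext c
    simp [em]
  refine Circ.isCircuit (G := contractEdge G u v x) ⟨?_, fun Y hY hYu => ?_⟩
  · rw [hslack _ (by simp [huv.ne']), huniv, h.total, if_pos (by simp [hux.ne'])]
    norm_num
  · obtain ⟨d, hd⟩ : ∃ d, d ∉ Y := by
      by_contra! hall
      exact hYu (Finset.eq_univ_iff_forall.2 hall)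
    by_cases hvY : v ∈ Y.map (.subtype _)
    · have hne : insert u (Y.map (.subtype (fun c => c ≠ u))) ≠ Finset.univ := by
        refine ne_univ_of_notMem (a := d.1) ?_
        rw [Finset.mem_insert, not_or]
        exact ⟨d.2, by simpa [d.2] using hd⟩
      have h4 := h.sparse _ ⟨u, Finset.mem_insert_self _ _⟩ hne
      rw [hslack Y hvY]
      split_ifs with hxY
      · omega
      · have hev := even_slack G (insert u (Y.map (.subtype (fun c => c ≠ u))))
        have h5 : slack G (insert u (Y.map (.subtype (fun c => c ≠ u)))) ≠ 4 := by
          intro h5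
          have := hZ _ ⟨hne, h5⟩ (Finset.mem_insert_self _ _) (Finset.mem_insert_of_mem hvY)
          exact hxY ((Finset.mem_insert.1 this).resolve_left hux.ne')
        rw [Int.even_iff] at hev
        omega
    · have h4 := h.sparse (Y.map (.subtype (fun c => c ≠ u))) (by simpa using hY)
        (ne_univ_of_notMem (a := u) (by simp))
      unfold slack at h4 ⊢
      rw [hcnt, if_neg hvY, add_zero]
      simpa using h4

lemma Circ.isCircuit_deletePairAddEdge (h : Circ G) {u₁ u₂ v₁ v₂ : V} (hv : v₁ ≠ v₂)
    (h₁ : ∀ c, G.Adj u₁ c ↔ c = u₂ ∨ c = v₁ ∨ c = v₂)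
    (h₂ : ∀ c, G.Adj u₂ c ↔ c = u₁ ∨ c = v₁ ∨ c = v₂) (hadj : ¬ G.Adj v₁ v₂) :
    IsCircuit (deletePairAddEdge G u₁ u₂ v₁ v₂ hv) := by
  classical
  have a12 : G.Adj u₁ u₂ := by simp [h₁]
  have a11 : G.Adj u₁ v₁ := by simp [h₁]
  have a1 : G.Adj u₁ v₂ := by simp [h₁]
  have a21 : G.Adj u₂ v₁ := by simp [h₂]
  have a22 : G.Adj u₂ v₂ := by simp [h₂]
  have hcnt : ∀ Y : Finset {c : V // c ≠ u₁ ∧ c ≠ u₂},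
      cnt (deletePairAddEdge G u₁ u₂ v₁ v₂ hv) Y Y =
      cnt G (Y.map (.subtype _)) (Y.map (.subtype _)) +
        if v₁ ∈ Y.map (.subtype _) ∧ v₂ ∈ Y.map (.subtype _) then 2 else 0 := by
    intro Y
    rw [cnt_subtype_join (G := G) (v := v₁) (S := (· = v₂)) (fun a b => Iff.rfl)]
    · simp only [Finset.sum_ite_eq']
      split_ifs <;> simp_all
    · rintro b rfl
      exact ⟨hv.symm, hadj⟩
  -- Two vertices are lost, and five edges are replaced by one: the changes of 8 cancel.
  have hslack : ∀ Y : Finset {c : V // c ≠ u₁ ∧ c ≠ u₂}, v₁ ∈ Y.map (.subtype _) →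
      v₂ ∈ Y.map (.subtype _) → slack (deletePairAddEdge G u₁ u₂ v₁ v₂ hv) Y =
        slack G (insert u₂ (insert u₁ (Y.map (.subtype _)))) := by
    intro Y hv1 hv2
    have hu1 : u₁ ∉ Y.map (.subtype (fun c => c ≠ u₁ ∧ c ≠ u₂)) := by simp
    have hu2 : u₂ ∉ Y.map (.subtype (fun c => c ≠ u₁ ∧ c ≠ u₂)) := by simp
    have hcY : ((Y.map (.subtype (fun c => c ≠ u₁ ∧ c ≠ u₂))).card : ℤ) = Y.card := by
      rw [Finset.card_map]
    have d1 : G.degree u₁ = 3 := by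
      rw [← G.card_neighborFinset_eq_degree, Finset.card_eq_three]
      exact ⟨u₂, v₁, v₂, a21.ne, a22.ne, hv, by ext c; simp [h₁]⟩
    have d2 : G.degree u₂ = 3 := by
      rw [← G.card_neighborFinset_eq_degree, Finset.card_eq_three]
      exact ⟨u₁, v₁, v₂, a11.ne, a1.ne, hv, by ext c; simp [h₂]⟩
    rw [slack_insert G (by rw [Finset.mem_insert, not_or]; exact ⟨a12.ne', hu2⟩),
      slack_insert G hu1, cnt_eq_two d1 a12 hu2, cnt_eq_three d2]
    · unfold slack
      rw [hcnt, if_pos ⟨hv1, hv2⟩, hcY]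
      ring
    · intro r hr
      rcases (h₂ r).1 hr with rfl | rfl | rfl
      exacts [Finset.mem_insert_self _ _, Finset.mem_insert_of_mem hv1,
        Finset.mem_insert_of_mem hv2]
    · intro r hr hru
      rcases (h₁ r).1 hr with rfl | rfl | rfl
      exacts [absurd rfl hru, hv1, hv2]
  have huniv : insert u₂ (insert u₁
      ((Finset.univ : Finset {c : V // c ≠ u₁ ∧ c ≠ u₂}).map (.subtype _))) = Finset.univ := by
    ext c
    simp only [Finset.mem_insert, Finset.mem_map, Finset.mem_univ, true_and, iff_true,
      Function.Embedding.subtype_apply, Subtype.exists, exists_prop, exists_eq_right]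
    tauto
  refine Circ.isCircuit (G := deletePairAddEdge G u₁ u₂ v₁ v₂ hv) ⟨?_, fun Y hY hYu => ?_⟩
  · rw [hslack _ (by simp [a11.ne', a21.ne']) (by simp [a1.ne', a22.ne']), huniv, h.total]
  · obtain ⟨d, hd⟩ : ∃ d, d ∉ Y := by
      by_contra! hall
      exact hYu (Finset.eq_univ_iff_forall.2 hall)
    by_cases hvY : v₁ ∈ Y.map (.subtype _) ∧ v₂ ∈ Y.map (.subtype _)
    · rw [hslack Y hvY.1 hvY.2]
      refine h.sparse _ ⟨u₂, Finset.mem_insert_self _ _⟩ (ne_univ_of_notMem (a := d.1) ?_)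
      rw [Finset.mem_insert, Finset.mem_insert, not_or, not_or]
      exact ⟨d.2.2, d.2.1, by simpa [d.2] using hd⟩
    · have h4 := h.sparse (Y.map (.subtype (fun c => c ≠ u₁ ∧ c ≠ u₂))) (by simpa using hY)
        (ne_univ_of_notMem (a := u₁) (by simp))
      unfold slack at h4 ⊢
      rw [hcnt, if_neg hvY, add_zero]
      simpa using h4

/-- Every circuit other than `K₅ - e` and `H₁` is obtained from a smaller one. -/
lemma Circ.exists_reduction (h : Circ G) (hK : IsEmpty (G ≃g K5e)) (hH : IsEmpty (G ≃g H1)) :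
    ∃ (W : Type u) (G' : SimpleGraph W), IsCircuit G' ∧ Nat.card W < Nat.card V ∧
      (IsK4MinusExtension G' G ∨ IsGeneralisedVertexSplit G' G) := by
  by_contra! hno
  refine Irreducible.false (G := G) ⟨h, ?_, ?_, hK, hH⟩
  · intro u v x huv hux hxv hcommon
    by_contra! hZ
    refine (hno _ _ (h.isCircuit_contractEdge huv hux hxv hcommon hZ) ?_).2 ?_
    · exact Finite.card_subtype_lt (x := u) (by simp)
    · refine isGeneralisedVertexSplit_contractEdge huv hux hxv hcommon ?_ ?_
      · by_contra! hall
        have hsub : G.neighborFinset u ⊆ {v, x} := by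
          intro c hc
          rw [G.mem_neighborFinset] at hc
          rw [Finset.mem_insert, Finset.mem_singleton]
          exact or_iff_not_imp_left.2 (hall c hc)
        have h1 := (Finset.card_le_card hsub).trans Finset.card_le_two
        have h2 := h.three_le_degree u
        rw [G.card_neighborFinset_eq_degree] at h1
        omega
      · by_contra! hall
        have hsub : G.neighborFinset v ⊆ {u} := by
          intro c hc
          rw [G.mem_neighborFinset] at hc
          simpa using hall c hc
        have h1 := Finset.card_le_card hsub
        have h2 := h.three_le_degree v
        rw [G.card_neighborFinset_eq_degree, Finset.card_singleton] at h1
        omega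
  · intro u₁ u₂ v₁ v₂ hv h₁ h₂
    by_contra hadj
    exact (hno _ _ (h.isCircuit_deletePairAddEdge hv h₁ h₂ hadj)
      (Finite.card_subtype_lt (x := u₁) (by simp))).1
      (isK4MinusExtension_deletePairAddEdge hv h₁ h₂ hadj)

end Reductions

lemma IsCircuit.obtainable {V : Type u} (G : SimpleGraph V) (hG : IsCircuit G) :
    ObtainableFrom K5e G ∨ ObtainableFrom H1 G := by
  classical
  induction hn : Nat.card V using Nat.strong_induction_on generalizing V with
  | _ n ih =>
    subst hn
    have := hG.finite
    have := Fintype.ofFinite V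
    rcases isEmpty_or_nonempty (G ≃g K5e) with hK | hK
    swap
    · exact Or.inl (.base G hK hG)
    rcases isEmpty_or_nonempty (G ≃g H1) with hH | hH
    swap
    · exact Or.inr (.base G hH hG)
    obtain ⟨W, G', hG', hlt, hop⟩ := (circ_of_isCircuit G hG).exists_reduction hK hH
    rcases ih _ hlt G' hG' rfl with ho | ho <;> rcases hop with hop | hop
    · exact Or.inl (.k4MinusExtension G' G ho hop hG)
    · exact Or.inl (.generalisedVertexSplit G' G ho hop hG)
    · exact Or.inr (.k4MinusExtension G' G ho hop hG)
    · exact Or.inr (.generalisedVertexSplit G' G ho hop hG)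

end CylinderRigidity

theorem theorem2p1 {V : Type*} (G : SimpleGraph V) (hG : CylinderRigidity.IsCircuit G) :
    CylinderRigidity.ObtainableFrom CylinderRigidity.K5e G ∨
      CylinderRigidity.ObtainableFrom CylinderRigidity.H1 G :=
  hG.obtainable
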